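/- Let $N\ge 1$ and let $\Omega\subset\mathbb{R}^N$ be a compact region with nonempty interior, equal to the closure of its interior, whose boundary is the disjoint union $\partial\Omega=\mathcal D\cup\mathcal L$ of two piecewise smooth hypersurfaces, $\mathcal D$ being nonempty; that is, outside a closed set of zero $(N-1)$-dimensional Hausdorff measure, $\partial\Omega$ is a $C^1$ hypersurface with $\Omega$ on one side, of which $\mathcal D$ and $\mathcal L$ are relatively open pieces. Let $n$ be the unit outward normal on $\partial\Omega$, wherever it exists. Let $\mathrm{Lin}_+$ be the set of real $N\times N$ matrices with positive determinant, $W\in C^2(\mathrm{Lin}_+,\mathbb{R})$, and $S(F)=DW(F)$. Suppose that (i) (Partition Condition) $x\cdot n(x)\ge 0$ for all $x\in\mathcal D$ and $x\cdot n(x)\le 0$ for all $x\in\mathcal L$ at which the normal exists; (ii) $W$ is rank-one convex: $W(A)-W(F)\ge S(F)\cdot(A-F)$ for all $A,F\in\mathrm{Lin}_+$ such that $A-F=a\otimes b$ with $a,b\in\mathbb{R}^N$; (iii) $F_0\in\mathrm{Lin}_+$ is a point of strict convexity of $W$: $W(F)>W(F_0)+S(F_0)\cdot(F-F_0)$ for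 all $F\in\mathrm{Lin}_+\setminus\{F_0\}$. Consider the mixed problem of finding a classical equilibrium, that is, a map $y$ on $\Omega$ that is $C^2$ in the interior of $\Omega$ and $C^1$ up to the boundary ($y$ is continuous on $\Omega$ and $\nabla y$ extends continuously from the interior to $\Omega$), with $\nabla y\in\mathrm{Lin}_+$ on $\Omega$ and $\operatorname{div}S(\nabla y)=0$ in the interior, subject to $y(x)=F_0x$ for all $x\in\mathcal D$ and $S(\nabla y)n=S(F_0)n$ on $\mathcal L$ wherever $n$ exists. Then the homogeneous deformation $y(x)=F_0x$, $x\in\Omega$, is a solution of this problem, and it is the only one. -/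

import Mathlib

open Set Filter Topology MeasureTheory

namespace Elastostatics

/-- The space of points and vectors: `ℝ^N` with its Euclidean structure. -/
abbrev Vec (N : ℕ) : Type := EuclideanSpace ℝ (Fin N)

/-- Tensors on `ℝ^N`. -/
abbrev Lin (N : ℕ) : Type := Vec N →L[ℝ] Vec N

/-- Tensors with positive determinant. -/
def LinPos (N : ℕ) : Set (Lin N) := {F | 0 < F.det}

/-- The `i`-th standard basis vector. -/
noncomputable def basisVec {N : ℕ} (i : Fin N) : Vec N := EuclideanSpace.single i 1

/-- The tensor product `a ⊗ b`, that is `x ↦ (b · x) a`. -/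
noncomputable def tensor {N : ℕ} (a b : Vec N) : Lin N := InnerProductSpace.rankOne ℝ a b

/-- The Piola stress tensor `S(F) = DW(F)`: the tensor whose `(i, j)` entry is the partial derivative
`∂W/∂F_ij`. The pairing `S(F) · A` (trace inner product) is the number `fderiv ℝ W F A`. -/
noncomputable def piola {N : ℕ} (W : Lin N → ℝ) (F : Lin N) : Lin N :=
  ∑ i, ∑ j, fderiv ℝ W F (tensor (basisVec i) (basisVec j)) • tensor (basisVec i) (basisVec j)

/-- The divergence of a tensor field, `(div T)_i = ∑ j, ∂_j T_ij`. -/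
noncomputable def tensorDiv {N : ℕ} (T : Vec N → Lin N) (x : Vec N) : Vec N :=
  ∑ j, (fderiv ℝ T x (basisVec j)) (basisVec j)

/-- Rank-one convexity of `W : Lin₊ → ℝ`. -/
def RankOneConvex {N : ℕ} (W : Lin N → ℝ) : Prop :=
  ∀ A ∈ LinPos N, ∀ F ∈ LinPos N, ∀ a b : Vec N, A - F = tensor a b →
    fderiv ℝ W F (A - F) ≤ W A - W F

/-- `F₀` is a point of strict convexity of `W : Lin₊ → ℝ`. -/
def StrictConvexityPoint {N : ℕ} (W : Lin N → ℝ) (F₀ : Lin N) : Prop :=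
  ∀ F ∈ LinPos N, F ≠ F₀ → W F₀ + fderiv ℝ W F₀ (F - F₀) < W F

/-- `n` is the unit outward normal of `Ω` at `p`: near `p` the boundary is a `C¹` hypersurface with
`Ω` on one side, `Ω = {φ ≤ 0}` for a `C¹` function `φ` with `φ p = 0`, `∇φ(p) = n`, `|n| = 1`. -/
def IsOuterUnitNormal {N : ℕ} (Ω : Set (Vec N)) (p n : Vec N) : Prop :=
  ‖n‖ = 1 ∧ ∃ (U : Set (Vec N)) (φ : Vec N → ℝ), IsOpen U ∧ p ∈ U ∧ ContDiffOn ℝ 1 φ U ∧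
    φ p = 0 ∧ HasGradientAt φ n p ∧ ∀ x ∈ U, x ∈ Ω ↔ φ x ≤ 0

/-- A compact region `Ω` of `ℝ^N` (the closure of its nonempty interior) whose boundary is the
disjoint union of two piecewise smooth hypersurfaces `D` (nonempty) and `L`: outside a closed set
`E` of zero `(N-1)`-dimensional measure (corners, edges, the interface of `D` and `L`), the boundary
is a `C¹` hypersurface, of which `D` and `L` are relatively open pieces. -/
structure IsPartitionedRegion {N : ℕ} (Ω D L : Set (Vec N)) : Prop where
  isCompact : IsCompact Ω
  closure_interior : closure (interior Ω) = Ω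
  interior_nonempty : (interior Ω).Nonempty
  union_eq : D ∪ L = frontier Ω
  disjoint : Disjoint D L
  nonempty : D.Nonempty
  piecewise_smooth : ∃ E : Set (Vec N), IsClosed E ∧ μH[(N : ℝ) - 1] E = 0 ∧
    (∀ x ∈ frontier Ω \ E, ∃ n, IsOuterUnitNormal Ω x n) ∧
    (∀ x ∈ D \ E, D ∈ 𝓝[frontier Ω] x) ∧
    (∀ x ∈ L \ E, L ∈ 𝓝[frontier Ω] x)

/-- The Partition Condition with respect to the origin, `n` being the unit outward normal
(wherever it exists). -/
def PartitionCondition {N : ℕ} (Ω D L : Set (Vec N)) : Prop :=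
  (∀ x ∈ D, ∀ n, IsOuterUnitNormal Ω x n → 0 ≤ inner ℝ x n) ∧
  (∀ x ∈ L, ∀ n, IsOuterUnitNormal Ω x n → inner ℝ x n ≤ 0)

/-- The deformation gradient `∇y` on the closed region `Ω`: the derivative in the interior, extended
to the boundary by continuity. -/
noncomputable def defGrad {N : ℕ} (Ω : Set (Vec N)) (y : Vec N → Vec N) : Vec N → Lin N :=
  extendFrom (interior Ω) (fderiv ℝ y)

/-- Classical equilibrium: `y` is `C²` in the interior of `Ω` and `C¹` up to the boundary (`y` and
`∇y` are continuous on `Ω`), with `∇y ∈ Lin₊` on `Ω` and `div S(∇y) = 0` in the interior. Only the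
values of `y` on `Ω` matter. -/
structure IsClassicalEquilibrium {N : ℕ} (Ω : Set (Vec N)) (W : Lin N → ℝ)
    (y : Vec N → Vec N) : Prop where
  contDiffOn : ContDiffOn ℝ 2 y (interior Ω)
  continuousOn : ContinuousOn y Ω
  continuousOn_grad : ContinuousOn (defGrad Ω y) Ω
  grad_mem : ∀ x ∈ Ω, defGrad Ω y x ∈ LinPos N
  div_eq_zero : ∀ x ∈ interior Ω, tensorDiv (fun z => piola W (fderiv ℝ y z)) x = 0

/-- The mixed problem with displacement `F₀ x` prescribed on `D` and dead-load traction `S(F₀) n`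
prescribed on `L` (wherever the normal `n` exists). -/
structure SolvesMixedProblem {N : ℕ} (Ω D L : Set (Vec N)) (W : Lin N → ℝ) (F₀ : Lin N)
    (y : Vec N → Vec N) : Prop where
  equilibrium : IsClassicalEquilibrium Ω W y
  displacement : ∀ x ∈ D, y x = F₀ x
  traction : ∀ x ∈ L, ∀ n, IsOuterUnitNormal Ω x n → piola W (defGrad Ω y x) n = piola W F₀ n

end Elastostatics

namespace Elastostatics

section

open scoped Manifold ContDiff

variable {N : ℕ}

/-! Write `F = ∇y`, `e = W(F) - W(F₀) - S(F₀)·(F - F₀)`, and consider the field `v = e x + (S(F) -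
S(F₀))ᵀ(y - F x)`. Equilibrium and the symmetry of second derivatives give `div v = N e`, which is
nonnegative by strict convexity at `F₀` (`divergence_energyFlux`).

At regular boundary points `v · n ≤ 0`. On `L` the traction condition removes the second term,
leaving `e (x · n) ≤ 0`. On `D` Hadamard's condition (`eq_tensor_of_eventually_eq_zero`) gives `F -
F₀ = a ⊗ n`, hence `y - F x = -(x · n) a` and `v · n = -(x · n) [W(F₀) - W(F) - S(F)·(F₀ - F)]`; the
bracket is nonnegative by rank-one convexity.

The divergence theorem then forces `e = 0`, so `F = F₀` in the interior. The interior need not be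
connected, so a second field is used: for `u = y - F₀ x`, now with zero gradient, `|u|² x` has
divergence `N |u|²`, vanishes on `D` and does not point outward on `L`. Hence `u = 0`.

Only an inequality form of the divergence theorem is needed (`eq_zero_of_divergence_nonneg`):
nonnegative divergence and no outward flux at regular boundary points imply zero divergence. It uses
no surface measure: interior cutoffs treat the regular boundary, and cutoffs of small total
variation remove the `(N-1)`-null singular set. -/

/-! ### Integration by parts with compact support -/

/-- The divergence of a vector field. -/
noncomputable def divergence (v : Vec N → Vec N) (x : Vec N) : ℝ :=
  ∑ j, (fderiv ℝ v x (basisVec j)) j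

theorem sum_apply_smul_basisVec (a : Vec N) : ∑ j, a j • basisVec j = a := by
  simpa [basisVec] using (EuclideanSpace.basisFun (Fin N) ℝ).sum_repr a

theorem continuous_mul_of_tsupport {X : Type*} [TopologicalSpace X] {η f : X → ℝ} {O : Set X}
    (hO : IsOpen O) (hη : Continuous η) (hf : ContinuousOn f O) (hs : tsupport η ⊆ O) :
    Continuous fun x => η x * f x := by
  refine continuous_of_tsupport fun x hx => ?_
  have hx' : x ∈ tsupport η := closure_mono (Function.support_mul_subset_left η f) hx
  exact hη.continuousAt.mul (hf.continuousAt (hO.mem_nhds (hs hx')))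

theorem contDiff_of_contDiffAt_tsupport {f : Vec N → ℝ}
    (h : ∀ x ∈ tsupport f, ContDiffAt ℝ 1 f x) : ContDiff ℝ 1 f := by
  refine contDiff_iff_contDiffAt.2 fun x => ?_
  by_cases hx : x ∈ tsupport f
  · exact h x hx
  · exact contDiffAt_const.congr_of_eventuallyEq (notMem_tsupport_iff_eventuallyEq.1 hx)

theorem integrable_mul_of_tsupport {η f : Vec N → ℝ} {O : Set (Vec N)} (hO : IsOpen O)
    (hη : Continuous η) (hηc : HasCompactSupport η) (hf : ContinuousOn f O)
    (hs : tsupport η ⊆ O) : Integrable fun x => η x * f x :=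
  (continuous_mul_of_tsupport hO hη hf hs).integrable_of_hasCompactSupport hηc.mul_right

/-- Integration by parts against a compactly supported function. -/
theorem integral_mul_divergence_add {O : Set (Vec N)} (hO : IsOpen O) {η : Vec N → ℝ}
    {v : Vec N → Vec N} (hη : ContDiff ℝ 1 η) (hηc : HasCompactSupport η)
    (hηO : tsupport η ⊆ O) (hv : ContDiffOn ℝ 1 v O) :
    ∫ x, (η x * divergence v x + fderiv ℝ η x (v x)) = 0 := by
  have hvd : ∀ x ∈ O, DifferentiableAt ℝ v x := fun x hx =>
    (hv.differentiableOn one_ne_zero).differentiableAt (hO.mem_nhds hx)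
  have hcomp : ∀ j : Fin N, ContDiffOn ℝ 1 (fun x => v x j) O := fun j =>
    (EuclideanSpace.proj j : Vec N →L[ℝ] ℝ).contDiff.comp_contDiffOn hv
  have hcd : ∀ j : Fin N, ∀ x ∈ O, fderiv ℝ (fun x => v x j) x (basisVec j)
      = (fderiv ℝ v x (basisVec j)) j := fun j x hx => by
    have := ((EuclideanSpace.proj j : Vec N →L[ℝ] ℝ).hasFDerivAt.comp x
      (hvd x hx).hasFDerivAt).fderiv
    exact congrArg (fun T => T (basisVec j)) this
  have hfc : ∀ j : Fin N, Continuous fun x => fderiv ℝ η x (basisVec j) := fun j =>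
    (hη.continuous_fderiv one_ne_zero).clm_apply continuous_const
  have hfs : ∀ j : Fin N, tsupport (fun x => fderiv ℝ η x (basisVec j)) ⊆ tsupport η := fun j =>
    tsupport_fderiv_apply_subset ℝ (basisVec j)
  have hi1 : ∀ j : Fin N, Integrable fun x => fderiv ℝ η x (basisVec j) * v x j := fun j =>
    integrable_mul_of_tsupport hO (hfc j) (hηc.fderiv_apply ℝ (basisVec j)) (hcomp j).continuousOn
      ((hfs j).trans hηO)
  have hi2 : ∀ j : Fin N, Integrable fun x => η x * fderiv ℝ (fun x => v x j) x (basisVec j) :=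
    fun j => integrable_mul_of_tsupport hO hη.continuous hηc
      (((hcomp j).continuousOn_fderiv_of_isOpen hO le_rfl).clm_apply continuousOn_const) hηO
  have hpart : ∀ j : Fin N, ∫ x, η x * fderiv ℝ (fun x => v x j) x (basisVec j)
      = -∫ x, fderiv ℝ η x (basisVec j) * v x j := fun j =>
    integral_mul_fderiv_eq_neg_fderiv_mul_of_integrable (hi1 j) (hi2 j)
      (integrable_mul_of_tsupport hO hη.continuous hηc (hcomp j).continuousOn hηO)
      (fun x _ => (hη.differentiable one_ne_zero) x)
      fun x hx => ((hcomp j).differentiableOn one_ne_zero).differentiableAt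
        (hO.mem_nhds (hηO hx))
  have hrw : (fun x => η x * divergence v x + fderiv ℝ η x (v x)) = fun x =>
      ∑ j, (η x * fderiv ℝ (fun x => v x j) x (basisVec j)
        + fderiv ℝ η x (basisVec j) * v x j) := by
    funext x
    rw [Finset.sum_add_distrib]
    congr 1
    -- The field is unconstrained outside `O`, where the two expressions for its divergence may
    -- differ, but there `η` vanishes.
    · by_cases hx : x ∈ O
      · rw [divergence, Finset.mul_sum]
        exact Finset.sum_congr rfl fun j _ => by rw [hcd j x hx]
      · have : η x = 0 := image_eq_zero_of_notMem_tsupport fun h => hx (hηO h)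
        simp [this]
    · conv_lhs => rw [← sum_apply_smul_basisVec (v x)]
      simp [mul_comm]
  rw [hrw, integral_finsetSum _ fun j _ => by exact (hi2 j).add (hi1 j)]
  refine Finset.sum_eq_zero fun j _ => ?_
  rw [integral_add (hi2 j) (hi1 j), hpart j, neg_add_cancel]

/-! ### Local geometry at a regular boundary point -/

/-- The local defining function of a region may be taken to be globally defined. -/
theorem IsOuterUnitNormal.exists_contDiff {Ω : Set (Vec N)} {p n : Vec N}
    (h : IsOuterUnitNormal Ω p n) :
    ‖n‖ = 1 ∧ ∃ (U : Set (Vec N)) (φ : Vec N → ℝ), IsOpen U ∧ p ∈ U ∧ ContDiff ℝ 1 φ ∧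
      φ p = 0 ∧ HasGradientAt φ n p ∧ ∀ x ∈ U, x ∈ Ω ↔ φ x ≤ 0 := by
  obtain ⟨hn, U, φ, hU, hpU, hφ, hφp, hgrad, hmem⟩ := h
  obtain ⟨ρ, hρ, hball⟩ := Metric.isOpen_iff.1 hU p hpU
  let β : ContDiffBump p := ⟨ρ / 3, ρ / 2, by positivity, by linarith⟩
  have hone : ∀ x ∈ Metric.ball p (ρ / 3), β x = 1 := fun x hx =>
    β.one_of_mem_closedBall (Metric.ball_subset_closedBall hx)
  have hsupp : tsupport (fun x => β x * φ x) ⊆ U := by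
    refine (closure_mono (Function.support_mul_subset_left (β : Vec N → ℝ) φ)).trans ?_
    change tsupport β ⊆ U
    rw [β.tsupport_eq]
    exact (Metric.closedBall_subset_ball (by change ρ / 2 < ρ; linarith)).trans hball
  have hp : p ∈ Metric.ball p (ρ / 3) := Metric.mem_ball_self (by positivity)
  refine ⟨hn, Metric.ball p (ρ / 3), fun x => β x * φ x, Metric.isOpen_ball, hp, ?_, by simp [hφp],
    ?_, fun x hx => ?_⟩
  · refine contDiff_of_contDiffAt_tsupport fun x hx => ?_
    exact β.contDiff.contDiffAt.mul (hφ.contDiffAt (hU.mem_nhds (hsupp hx)))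
  · refine hgrad.congr_of_eventuallyEq ?_
    filter_upwards [Metric.isOpen_ball.mem_nhds hp] with x hx
    simp [hone x hx]
  · rw [hmem x (hball (Metric.ball_subset_ball (by linarith) hx))]
    simp [hone x hx]

/-- A regular boundary point: coordinate-free local description of the region. -/
theorem IsOuterUnitNormal.exists_ball {Ω E : Set (Vec N)} {p n : Vec N} (hE : IsClosed E)
    (hpE : p ∉ E) (h : IsOuterUnitNormal Ω p n) :
    ∃ ρ > 0, ρ ≤ 1 ∧ ∃ φ : Vec N → ℝ, φ p = 0 ∧ HasGradientAt φ n p ∧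
      ContDiff ℝ 1 φ ∧
      (∀ x ∈ Metric.ball p ρ, x ∉ E) ∧
      (∀ x ∈ Metric.ball p ρ, x ∈ Ω ↔ φ x ≤ 0) ∧
      (∀ x ∈ Metric.ball p ρ, x ∈ interior Ω ↔ φ x < 0) ∧
      (∀ x ∈ Metric.ball p ρ, x ∈ frontier Ω ↔ φ x = 0) ∧
      (∀ x ∈ Metric.ball p ρ, 1 / 2 ≤ fderiv ℝ φ x n) ∧
      (∀ x ∈ Metric.ball p ρ, φ x = 0 → ∃ m : Vec N, ∃ c : ℝ, 0 < c ∧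
        IsOuterUnitNormal Ω x m ∧ ∀ w, fderiv ℝ φ x w = c * inner ℝ w m) := by
  obtain ⟨hn, U, φ, hU, hpU, hφ, hφp, hgrad, hmem⟩ := h.exists_contDiff
  have hder : ContinuousOn (fun x => fderiv ℝ φ x n) U :=
    ((hφ.continuous_fderiv one_ne_zero).clm_apply continuous_const).continuousOn
  have hp1 : fderiv ℝ φ p n = 1 := by
    rw [hgrad.hasFDerivAt.fderiv]
    simp [hn]
  have hev : ∀ᶠ x in 𝓝 p, x ∈ U ∧ x ∉ E ∧ 1 / 2 < fderiv ℝ φ x n := by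
    refine Filter.Eventually.and (hU.mem_nhds hpU)
      (Filter.Eventually.and (hE.isOpen_compl.mem_nhds hpE) ?_)
    exact (hder.continuousAt (hU.mem_nhds hpU)).eventually (lt_mem_nhds (by simp only [hp1]; norm_num))
  obtain ⟨ρ, hρ, hball⟩ := Metric.eventually_nhds_iff_ball.1 hev
  have hsub : Metric.ball p (min ρ 1) ⊆ Metric.ball p ρ := Metric.ball_subset_ball (min_le_left _ _)
  have hball' := fun x hx => hball x (hsub hx)
  have hBU : Metric.ball p (min ρ 1) ⊆ U := fun x hx => (hball' x hx).1
  have hd : ∀ x ∈ U, HasFDerivAt φ (fderiv ℝ φ x) x := fun x _ =>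
    (hφ.differentiable one_ne_zero x).hasFDerivAt
  have hΩ : ∀ x ∈ Metric.ball p (min ρ 1), x ∈ Ω ↔ φ x ≤ 0 := fun x hx => hmem x (hBU hx)
  have hcont : ∀ x ∈ U, ContinuousAt φ x := fun x hx => (hd x hx).continuousAt
  have hint : ∀ x ∈ Metric.ball p (min ρ 1), x ∈ interior Ω ↔ φ x < 0 := by
    intro x hx
    constructor
    · intro hxi
      refine lt_of_le_of_ne ((hΩ x hx).1 (interior_subset hxi)) fun h0 => ?_
      -- At an interior point of `Ω` on `{φ = 0}`, `φ` along the line in direction `n` would have a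
      -- local maximum with nonzero derivative.
      have hline : HasDerivAt (fun s : ℝ => φ (x + s • n)) (fderiv ℝ φ x n) 0 := by
        have h1 : HasDerivAt (fun s : ℝ => x + s • n) n 0 := by
          simpa using ((hasDerivAt_id (0 : ℝ)).smul_const n).const_add x
        have h2 : HasFDerivAt φ (fderiv ℝ φ x) (x + (0 : ℝ) • n) := by simpa using hd x (hBU hx)
        exact h2.comp_hasDerivAt 0 h1
      have hpos : 0 < fderiv ℝ φ x n := by linarith [(hball' x hx).2.2]
      have hmax : IsLocalMax (fun s : ℝ => φ (x + s • n)) 0 := by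
        have hc : Tendsto (fun s : ℝ => x + s • n) (𝓝 0) (𝓝 x) := by
          have : Continuous fun s : ℝ => x + s • n := by fun_prop
          simpa using this.tendsto 0
        filter_upwards [hc.eventually (isOpen_interior.mem_nhds hxi),
          hc.eventually (Metric.isOpen_ball.mem_nhds hx)] with s hs hs2
        simpa [h0] using (hΩ _ hs2).1 (interior_subset hs)
      exact hpos.ne' (hmax.hasDerivAt_eq_zero hline)
    · intro hlt
      rw [mem_interior_iff_mem_nhds]
      filter_upwards [(hcont x (hBU hx)).eventually (gt_mem_nhds hlt),
        Metric.isOpen_ball.mem_nhds hx] with z hz hz2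
      exact (hΩ z hz2).2 hz.le
  refine ⟨min ρ 1, lt_min hρ one_pos, min_le_right _ _, φ, hφp, hgrad, hφ,
    fun x hx => (hball' x hx).2.1, hΩ, hint, ?_, fun x hx => (hball' x hx).2.2.le, ?_⟩
  · intro x hx
    constructor
    · intro hf
      have h1 : ¬ φ x < 0 := fun h => hf.2 ((hint x hx).2 h)
      by_contra hne
      have h2 : 0 < φ x := lt_of_le_of_ne (not_lt.1 h1) (Ne.symm hne)
      have h3 : ∀ᶠ z in 𝓝 x, z ∉ Ω := by
        filter_upwards [(hcont x (hBU hx)).eventually (lt_mem_nhds h2),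
          Metric.isOpen_ball.mem_nhds hx] with z hz hz2 hzΩ
        exact absurd ((hΩ z hz2).1 hzΩ) (not_le.2 hz)
      exact (mem_closure_iff_frequently.1 hf.1) h3
    · intro h0
      exact ⟨subset_closure ((hΩ x hx).2 h0.le), fun hi => ((hint x hx).1 hi).ne h0⟩
  · intro x hx h0
    -- With `m = ∇φ(x) ≠ 0`, the function `φ / ‖m‖` exhibits `m / ‖m‖` as the outer normal at the
    -- nearby boundary point `x`.
    set m := (InnerProductSpace.toDual ℝ (Vec N)).symm (fderiv ℝ φ x) with hm
    have hmw : ∀ w, fderiv ℝ φ x w = inner ℝ m w := fun w => by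
      rw [hm, InnerProductSpace.toDual_symm_apply]
    have hm0 : 0 < ‖m‖ := by
      rw [norm_pos_iff]
      intro h
      have := (hball' x hx).2.2
      rw [hmw, h, inner_zero_left] at this
      linarith
    refine ⟨‖m‖⁻¹ • m, ‖m‖, hm0, ⟨?_, Metric.ball p (min ρ 1), fun z => ‖m‖⁻¹ * φ z,
      Metric.isOpen_ball, hx, contDiffOn_const.mul hφ.contDiffOn, by simp [h0], ?_, ?_⟩, ?_⟩
    · rw [norm_smul, norm_inv, norm_norm, inv_mul_cancel₀ hm0.ne']
    · have h1 : HasGradientAt φ m x := by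
        rw [hasGradientAt_iff_hasFDerivAt, hm, LinearIsometryEquiv.apply_symm_apply]
        exact hd x (hBU hx)
      rw [hasGradientAt_iff_hasFDerivAt, map_smulₛₗ]
      exact h1.hasFDerivAt.const_mul _
    · intro z hz
      rw [hΩ z hz]
      have hc := inv_pos.2 hm0
      exact ⟨fun h => mul_nonpos_of_nonneg_of_nonpos hc.le h,
        fun h => nonpos_of_mul_nonpos_right h hc⟩
    · intro w
      rw [hmw, inner_smul_right, real_inner_comm, ← mul_assoc, mul_inv_cancel₀ hm0.ne', one_mul]

/-! ### Divergence inequality near a regular boundary point -/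

/-- A smooth decreasing cutoff, equal to `1` on `(-∞, -2]` and to `0` on `[-1, ∞)`. -/
noncomputable def stepDown (s : ℝ) : ℝ := Real.smoothTransition (-s - 1)

theorem stepDown_contDiff : ContDiff ℝ 1 stepDown :=
  (Real.smoothTransition.contDiff (n := 1)).comp (by fun_prop)

theorem stepDown_antitone : Antitone stepDown := fun a b h =>
  Real.smoothTransition.monotone (by linarith)

theorem stepDown_eq_one {s : ℝ} (h : s ≤ -2) : stepDown s = 1 :=
  Real.smoothTransition.one_of_one_le (by linarith)

theorem stepDown_eq_zero {s : ℝ} (h : -1 ≤ s) : stepDown s = 0 :=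
  Real.smoothTransition.zero_of_nonpos (by linarith)

theorem abs_stepDown_le_one (s : ℝ) : |stepDown s| ≤ 1 := by
  rw [stepDown, abs_of_nonneg (Real.smoothTransition.nonneg _)]
  exact Real.smoothTransition.le_one _

theorem deriv_stepDown_eq_zero {s : ℝ} (h : s < -2) : deriv stepDown s = 0 := by
  have : stepDown =ᶠ[𝓝 s] fun _ => (1 : ℝ) := by
    filter_upwards [gt_mem_nhds h] with z hz using stepDown_eq_one hz.le
  rw [this.deriv_eq, deriv_const]

theorem integrableOn_divergence_form {Ω : Set (Vec N)} (hΩ : IsCompact Ω) {χ g : Vec N → ℝ}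
    {v : Vec N → Vec N} (hχ : ContDiff ℝ 1 χ) (hg : ContinuousOn g Ω) (hv : ContinuousOn v Ω) :
    IntegrableOn (fun x => χ x * g x + fderiv ℝ χ x (v x)) (interior Ω) := by
  have : ContinuousOn (fun x => χ x * g x + fderiv ℝ χ x (v x)) Ω :=
    (hχ.continuous.continuousOn.mul hg).add
      ((hχ.continuous_fderiv one_ne_zero).continuousOn.clm_apply hv)
  exact (this.integrableOn_compact hΩ).mono_set interior_subset

/-- The divergence inequality localised near a piece of the boundary through which the field points
strictly inward. -/
theorem setIntegral_nonpos_of_strictly_inward {Ω : Set (Vec N)} (hΩ : IsCompact Ω)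
    {v : Vec N → Vec N} {g φ χ : Vec N → ℝ} {B : Set (Vec N)}
    (hv : ContinuousOn v Ω) (hv1 : ContDiffOn ℝ 1 v (interior Ω)) (hg : ContinuousOn g Ω)
    (hdiv : ∀ x ∈ interior Ω, divergence v x = g x) (hφ : ContDiff ℝ 1 φ)
    (hmem : ∀ x ∈ B, x ∈ Ω ↔ φ x ≤ 0) (hint : ∀ x ∈ B, x ∈ interior Ω ↔ φ x < 0)
    (hin : ∀ x ∈ B, φ x = 0 → fderiv ℝ φ x (v x) < 0)
    (hχ : ContDiff ℝ 1 χ) (hχ0 : ∀ x, 0 ≤ χ x) (hχc : HasCompactSupport χ) (hχB : tsupport χ ⊆ B) :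
    ∫ x in interior Ω, (χ x * g x + fderiv ℝ χ x (v x)) ≤ 0 := by
  have hclosed : IsClosed Ω := hΩ.isClosed
  -- away from a thin layer at the boundary nothing is flowing out
  obtain ⟨m, hm, hlayer⟩ : ∃ m > 0, ∀ x ∈ tsupport χ ∩ Ω, 0 ≤ fderiv ℝ φ x (v x) → φ x ≤ -m := by
    have hc : ContinuousOn (fun x => fderiv ℝ φ x (v x)) (tsupport χ ∩ Ω) :=
      ((hφ.continuous_fderiv one_ne_zero).continuousOn.clm_apply hv).mono inter_subset_right
    have hK : IsCompact ((tsupport χ ∩ Ω) ∩ (fun x => fderiv ℝ φ x (v x)) ⁻¹' Ici 0) :=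
      (hΩ.inter_left (isClosed_tsupport χ)).of_isClosed_subset
        (hc.preimage_isClosed_of_isClosed ((isClosed_tsupport χ).inter hclosed) isClosed_Ici)
        inter_subset_left
    rcases ((tsupport χ ∩ Ω) ∩ (fun x => fderiv ℝ φ x (v x)) ⁻¹' Ici 0).eq_empty_or_nonempty
      with he | hne
    · refine ⟨1, one_pos, fun x hx h0 => ?_⟩
      have : x ∈ (∅ : Set (Vec N)) := he ▸ ⟨hx, h0⟩
      exact this.elim
    · obtain ⟨z, hz, hmax⟩ := hK.exists_isMaxOn hne hφ.continuous.continuousOn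
      have hzB := hχB hz.1.1
      have hz0 : φ z < 0 := by
        refine lt_of_le_of_ne ((hmem z hzB).1 hz.1.2) fun h => ?_
        exact absurd hz.2 (not_le.2 (hin z hzB h))
      exact ⟨-φ z, by linarith, fun x hx h0 => by rw [neg_neg]; exact hmax ⟨hx, h0⟩⟩
  have hcut : ∀ k : ℝ, ContDiff ℝ 1 fun x => stepDown (k * φ x) := fun k =>
    stepDown_contDiff.comp (contDiff_const.mul hφ)
  have hcutd : ∀ k x w, fderiv ℝ (fun x => stepDown (k * φ x)) x w
      = deriv stepDown (k * φ x) * (k * fderiv ℝ φ x w) := by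
    intro k x w
    have h1 := (stepDown_contDiff.differentiable one_ne_zero (k * φ x)).hasDerivAt
    have h2 : HasFDerivAt (fun x => k * φ x) (k • fderiv ℝ φ x) x :=
      (hφ.differentiable one_ne_zero x).hasFDerivAt.const_mul k
    have h3 := h1.comp_hasFDerivAt x h2
    rw [Function.comp_def] at h3
    rw [h3.fderiv]
    simp
  have hη : ∀ k : ℝ, ContDiff ℝ 1 fun x => χ x * stepDown (k * φ x) := fun k => hχ.mul (hcut k)
  have hηd : ∀ k x w, fderiv ℝ (fun x => χ x * stepDown (k * φ x)) x w
      = stepDown (k * φ x) * fderiv ℝ χ x w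
        + χ x * (deriv stepDown (k * φ x) * (k * fderiv ℝ φ x w)) := by
    intro k x w
    have h1 := (hχ.differentiable one_ne_zero x).hasFDerivAt
    have h2 := ((hcut k).differentiable one_ne_zero x).hasFDerivAt
    have h3 : HasFDerivAt (fun x => χ x * stepDown (k * φ x)) _ x := h1.mul h2
    rw [h3.fderiv]
    simp only [add_apply, smul_apply, smul_eq_mul, hcutd]
    ring
  -- Integrate by parts against `χ · stepDown (k φ)`, supported in the interior because the second
  -- factor vanishes where `k φ ≥ -1`. The term in which the cutoff is differentiated has a
  -- favourable sign once its transition layer `-2 ≤ k φ ≤ -1` lies in `φ > -m`.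
  have hle : ∀ k : ℝ, 2 / m < k →
      ∫ x in interior Ω, stepDown (k * φ x) * (χ x * g x + fderiv ℝ χ x (v x)) ≤ 0 := by
    intro k hk
    have hk0 : 0 < k := lt_trans (by positivity) hk
    have hsupp : tsupport (fun x => χ x * stepDown (k * φ x)) ⊆ interior Ω := by
      intro x hx
      have hxχ : x ∈ tsupport χ := closure_mono (Function.support_mul_subset_left χ _) hx
      rw [hint x (hχB hxχ)]
      by_contra hcon
      refine (notMem_tsupport_iff_eventuallyEq.2 ?_) hx
      have : -1 < k * φ x := by nlinarith [mul_nonneg hk0.le (not_lt.1 hcon)]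
      have hc : ContinuousAt (fun x => k * φ x) x := (continuous_const.mul hφ.continuous).continuousAt
      filter_upwards [hc.eventually (lt_mem_nhds this)] with z hz
      simp [stepDown_eq_zero (le_of_lt hz)]
    have hibp := integral_mul_divergence_add isOpen_interior (hη k) hχc.mul_right hsupp hv1
    rw [← setIntegral_eq_integral_of_forall_compl_eq_zero (s := interior Ω)] at hibp
    · rw [← hibp]
      have hint1 := integrableOn_divergence_form hΩ hχ hg hv
      have hint2 := integrableOn_divergence_form hΩ (hη k) hg hv
      refine setIntegral_mono_on ?_ ?_ isOpen_interior.measurableSet ?_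
      · refine hint1.bdd_mul (hcut k).continuous.aestronglyMeasurable (c := 1) ?_
        exact Eventually.of_forall fun x => abs_stepDown_le_one _
      · refine hint2.congr_fun (fun x hx => ?_) isOpen_interior.measurableSet
        simp only [hdiv x hx]
      · intro x hx
        rw [hdiv x hx, hηd]
        -- Either `v` does not decrease `φ`, and then `k φ < -2`, where the cutoff is constant; or
        -- `∂φ(v) < 0`, and its product with `deriv stepDown ≤ 0` is nonnegative.
        have : 0 ≤ χ x * (deriv stepDown (k * φ x) * (k * fderiv ℝ φ x (v x))) := by
          by_cases hxχ : x ∈ tsupport χ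
          · refine mul_nonneg (hχ0 x) ?_
            rcases le_or_gt 0 (fderiv ℝ φ x (v x)) with h0 | h0
            · have h1 := hlayer x ⟨hxχ, interior_subset hx⟩ h0
              have h2 : k * φ x < -2 := by
                rw [div_lt_iff₀ hm] at hk
                nlinarith [mul_le_mul_of_nonneg_left h1 hk0.le]
              rw [deriv_stepDown_eq_zero h2, zero_mul]
            · exact mul_nonneg_of_nonpos_of_nonpos stepDown_antitone.deriv_nonpos
                (mul_nonpos_of_nonneg_of_nonpos hk0.le h0.le)
          · rw [image_eq_zero_of_notMem_tsupport hxχ, zero_mul]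
        linarith
    · intro x hx
      have hx' : x ∉ tsupport fun x => χ x * stepDown (k * φ x) := fun h => hx (hsupp h)
      rw [image_eq_zero_of_notMem_tsupport hx', fderiv_of_notMem_tsupport ℝ hx']
      simp
  -- As `k → ∞` the cutoff tends to `1` at each interior point of `supp χ`, with integrands
  -- dominated by the limit integrand.
  have hlim : Tendsto (fun k : ℕ => ∫ x in interior Ω,
      stepDown (k * φ x) * (χ x * g x + fderiv ℝ χ x (v x))) atTop
      (𝓝 (∫ x in interior Ω, (χ x * g x + fderiv ℝ χ x (v x)))) := by
    have hint1 := integrableOn_divergence_form hΩ hχ hg hv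
    refine tendsto_integral_of_dominated_convergence
      (fun x => ‖χ x * g x + fderiv ℝ χ x (v x)‖) (fun k => ?_) hint1.norm (fun k => ?_) ?_
    · exact (hcut k).continuous.aestronglyMeasurable.mul hint1.aestronglyMeasurable
    · refine Eventually.of_forall fun x => ?_
      rw [norm_mul]
      exact mul_le_of_le_one_left (norm_nonneg _) (abs_stepDown_le_one _)
    · refine (ae_restrict_iff' isOpen_interior.measurableSet).2 (Eventually.of_forall fun x hx => ?_)
      by_cases hxχ : x ∈ tsupport χ
      · have h0 : φ x < 0 := (hint x (hχB hxχ)).1 hx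
        refine tendsto_const_nhds.congr' ?_
        filter_upwards [(tendsto_natCast_atTop_atTop (R := ℝ)).eventually_ge_atTop (2 / -φ x)]
          with k hk
        rw [div_le_iff₀ (by linarith)] at hk
        rw [stepDown_eq_one (by linarith), one_mul]
      · rw [image_eq_zero_of_notMem_tsupport hxχ, fderiv_of_notMem_tsupport ℝ hxχ]
        simp
  refine le_of_tendsto hlim ?_
  filter_upwards [(tendsto_natCast_atTop_atTop (R := ℝ)).eventually_gt_atTop (2 / m)] with k hk
  exact hle k hk

theorem divergence_sub_const {v : Vec N → Vec N} (a : Vec N) (x : Vec N) :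
    divergence (fun z => v z - a) x = divergence v x := by
  simp [divergence, fderiv_sub_const]

/-- The divergence inequality localised near a regular boundary point. -/
theorem exists_ball_setIntegral_nonpos {Ω E : Set (Vec N)} (hΩ : IsCompact Ω) (hE : IsClosed E)
    {v : Vec N → Vec N} {g : Vec N → ℝ}
    (hv : ContinuousOn v Ω) (hv1 : ContDiffOn ℝ 1 v (interior Ω)) (hg : ContinuousOn g Ω)
    (hdiv : ∀ x ∈ interior Ω, divergence v x = g x)
    (hin : ∀ x ∈ frontier Ω \ E, ∀ n, IsOuterUnitNormal Ω x n → inner ℝ (v x) n ≤ 0)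
    {p n : Vec N} (hp : p ∉ E) (hn : IsOuterUnitNormal Ω p n) :
    ∃ ρ > 0, ∀ χ : Vec N → ℝ, ContDiff ℝ 1 χ → (∀ x, 0 ≤ χ x) → tsupport χ ⊆ Metric.ball p ρ →
      ∫ x in interior Ω, (χ x * g x + fderiv ℝ χ x (v x)) ≤ 0 := by
  obtain ⟨ρ, hρ, -, φ, -, -, hφ, hBE, hmem, hint, hfr, hder, hnormal⟩ := hn.exists_ball hE hp
  refine ⟨ρ, hρ, fun χ hχ hχ0 hχB => ?_⟩
  have hχc : HasCompactSupport χ := Metric.isCompact_of_isClosed_isBounded (isClosed_tsupport χ)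
    (Metric.isBounded_ball.subset hχB)
  have hi1 := integrableOn_divergence_form hΩ hχ hg hv
  have hi2 : IntegrableOn (fun x => fderiv ℝ χ x n) (interior Ω) := by
    simpa using integrableOn_divergence_form hΩ hχ (continuousOn_const (c := (0 : ℝ)))
      (continuousOn_const (c := n))
  -- Subtracting `δ n` leaves the divergence unchanged and makes the field strictly inward, since
  -- `∂φ(n) ≥ 1/2` near `p`; then `δ → 0`.
  have key : ∀ δ : ℝ, 0 < δ → ∫ x in interior Ω, (χ x * g x + fderiv ℝ χ x (v x))
      ≤ δ * ∫ x in interior Ω, fderiv ℝ χ x n := by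
    intro δ hδ
    have := setIntegral_nonpos_of_strictly_inward (v := fun x => v x - δ • n) hΩ
      (hv.sub continuousOn_const) (hv1.sub contDiffOn_const) hg
      (fun x hx => by rw [divergence_sub_const, hdiv x hx]) hφ hmem hint
      (fun x hx h0 => ?_) hχ hχ0 hχc hχB
    · have h2 : (fun x => χ x * g x + fderiv ℝ χ x (v x - δ • n)) =
          fun x => (χ x * g x + fderiv ℝ χ x (v x)) - δ * fderiv ℝ χ x n := by
        funext x
        rw [map_sub, map_smul, smul_eq_mul]
        ring
      rw [h2, integral_sub hi1 (hi2.const_mul δ), integral_const_mul] at this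
      linarith
    · obtain ⟨m, c, hc, hm, hval⟩ := hnormal x hx h0
      have h1 : fderiv ℝ φ x (v x) ≤ 0 := by
        rw [hval]
        exact mul_nonpos_of_nonneg_of_nonpos hc.le (hin x ⟨(hfr x hx).2 h0, hBE x hx⟩ m hm)
      rw [map_sub, map_smul, smul_eq_mul]
      nlinarith [hder x hx]
  have hlim : Tendsto (fun δ : ℝ => δ * ∫ x in interior Ω, fderiv ℝ χ x n) (𝓝[>] 0) (𝓝 0) := by
    have : Tendsto (fun δ : ℝ => δ * ∫ x in interior Ω, fderiv ℝ χ x n) (𝓝 0)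
        (𝓝 (0 * ∫ x in interior Ω, fderiv ℝ χ x n)) := tendsto_id.mul_const _
    rw [zero_mul] at this
    exact this.mono_left nhdsWithin_le_nhds
  exact ge_of_tendsto hlim (eventually_mem_nhdsWithin.mono fun δ hδ => key δ hδ)

/-! ### Cutoffs around the singular set -/

/-- A compact set of zero Hausdorff measure is covered by finitely many small balls centred on it,
with small total content. -/
theorem exists_finite_ball_cover {K : Set (Vec N)} (hK : IsCompact K) {d : ℝ} (hd : 0 ≤ d)
    (h : μH[d] K = 0) {ε δ : ℝ} (hε : 0 < ε) (hδ : 0 < δ) :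
    ∃ (s : Finset ℕ) (c : ℕ → Vec N) (r : ℕ → ℝ),
      (∀ n ∈ s, c n ∈ K ∧ 0 < r n ∧ r n < δ) ∧ K ⊆ ⋃ n ∈ s, Metric.ball (c n) (r n) ∧
      ∑ n ∈ s, r n ^ d < ε := by
  have hε2 : (0 : ENNReal) < ENNReal.ofReal (ε / 2) := ENNReal.ofReal_pos.2 (by positivity)
  have hδ2 : (0 : ENNReal) < ENNReal.ofReal (δ / 2) := ENNReal.ofReal_pos.2 (by positivity)
  rw [Measure.hausdorffMeasure_apply] at h
  have h1 := (iSup₂_le_iff.1 h.le) (ENNReal.ofReal (δ / 2)) hδ2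
  have h2 := lt_of_le_of_lt h1 hε2
  simp only [iInf_lt_iff] at h2
  obtain ⟨t, hcov, hdiam, hsum⟩ := h2
  -- The summable slack `e` allows each covering set to be replaced by an open ball of radius
  -- strictly larger than its diameter, hence positive even when the set is a single point.
  obtain ⟨e, he, hesum⟩ := ENNReal.exists_pos_sum_of_countable' hε2.ne' ℕ
  have hex : ∀ n, (t n ∩ K).Nonempty → ∃ (c : Vec N) (r : ℝ), c ∈ K ∧ 0 < r ∧ r < δ ∧
      t n ⊆ Metric.ball c r ∧ ENNReal.ofReal r ^ d ≤ Metric.ediam (t n) ^ d + e n := by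
    rintro n ⟨c, hct, hcK⟩
    have hfin : Metric.ediam (t n) ≠ ⊤ := ((hdiam n).trans_lt ENNReal.ofReal_lt_top).ne
    have hD : (Metric.ediam (t n)).toReal < δ := by
      have := ENNReal.toReal_mono ENNReal.ofReal_ne_top (hdiam n)
      rw [ENNReal.toReal_ofReal (by positivity)] at this
      linarith
    have hcont : Continuous fun r : ℝ => ENNReal.ofReal r ^ d :=
      ENNReal.continuous_rpow_const.comp ENNReal.continuous_ofReal
    have hlt : ENNReal.ofReal (Metric.ediam (t n)).toReal ^ d < Metric.ediam (t n) ^ d + e n := by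
      rw [ENNReal.ofReal_toReal hfin]
      exact ENNReal.lt_add_right (ENNReal.rpow_ne_top_of_nonneg hd hfin) (he n).ne'
    have hev : ∀ᶠ r in 𝓝[>] (Metric.ediam (t n)).toReal, r < δ ∧
        ENNReal.ofReal r ^ d < Metric.ediam (t n) ^ d + e n :=
      ((gt_mem_nhds hD).and (hcont.continuousAt.eventually (gt_mem_nhds hlt))).filter_mono
        nhdsWithin_le_nhds
    obtain ⟨r, ⟨hr1, hr2⟩, hr3⟩ := (hev.and eventually_mem_nhdsWithin).exists
    refine ⟨c, r, hcK, lt_of_le_of_lt ENNReal.toReal_nonneg hr3, hr1, fun x hx => ?_, hr2.le⟩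
    have hb : edist x c ≤ Metric.ediam (t n) := Metric.edist_le_ediam_of_mem hx hct
    have hb' := ENNReal.toReal_mono hfin hb
    rw [← dist_edist] at hb'
    exact lt_of_le_of_lt hb' hr3
  choose! c r hcK hr0 hrδ hball hrd using hex
  obtain ⟨b, hbsub, hbfin, hbcov⟩ := hK.elim_finite_subcover_image
    (b := {n | (t n ∩ K).Nonempty}) (c := fun n => Metric.ball (c n) (r n))
    (fun n _ => Metric.isOpen_ball) (fun x hx => by
      obtain ⟨n, hn⟩ := mem_iUnion.1 (hcov hx)
      exact mem_iUnion₂.2 ⟨n, ⟨x, hn, hx⟩, hball n ⟨x, hn, hx⟩ hn⟩)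
  have hmem : ∀ n ∈ hbfin.toFinset, (t n ∩ K).Nonempty := fun n hn =>
    hbsub (hbfin.mem_toFinset.1 hn)
  refine ⟨hbfin.toFinset, c, r, fun n hn => ⟨hcK n (hmem n hn), hr0 n (hmem n hn),
    hrδ n (hmem n hn)⟩, by simpa using hbcov, ?_⟩
  rw [← ENNReal.ofReal_lt_ofReal_iff hε]
  calc ENNReal.ofReal (∑ n ∈ hbfin.toFinset, r n ^ d)
      = ∑ n ∈ hbfin.toFinset, ENNReal.ofReal (r n) ^ d := by
        rw [ENNReal.ofReal_sum_of_nonneg fun n hn => Real.rpow_nonneg (hr0 n (hmem n hn)).le d]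
        exact Finset.sum_congr rfl fun n hn =>
          (ENNReal.ofReal_rpow_of_nonneg (hr0 n (hmem n hn)).le hd).symm
    _ ≤ ∑ n ∈ hbfin.toFinset, ((⨆ _ : (t n).Nonempty, Metric.ediam (t n) ^ d) + e n) := by
        refine Finset.sum_le_sum fun n hn => (hrd n (hmem n hn)).trans ?_
        gcongr
        -- The supremum over nonemptiness keeps empty sets from contributing `0 ^ 0 = 1` when `d =
        -- 0`, the case `N = 1`; the sets kept here meet `K`.
        exact le_iSup (fun _ : (t n).Nonempty => Metric.ediam (t n) ^ d) (hmem n hn).left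
    _ ≤ (∑' n, ⨆ _ : (t n).Nonempty, Metric.ediam (t n) ^ d) + ∑' n, e n := by
        rw [Finset.sum_add_distrib]
        exact add_le_add (ENNReal.sum_le_tsum _) (ENNReal.sum_le_tsum _)
    _ < ENNReal.ofReal (ε / 2) + ENNReal.ofReal (ε / 2) := ENNReal.add_lt_add hsum hesum
    _ = ENNReal.ofReal ε := by
        rw [← ENNReal.ofReal_add (by positivity) (by positivity), add_halves]

/-- Scaling a fixed bump by `r` multiplies its gradient by `r⁻¹` and volumes by `r ^ N`, whence the
power `N - 1` that matches the dimension of the Hausdorff measure. -/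
theorem exists_ball_cutoff (N : ℕ) : ∃ C : ℝ, 0 ≤ C ∧ ∀ (c : Vec N) (r : ℝ), 0 < r →
    ∃ b : Vec N → ℝ, ContDiff ℝ 1 b ∧ (∀ x, 0 ≤ b x) ∧ (∀ x, b x ≤ 1) ∧
      (∀ x ∈ Metric.ball c r, b x = 1) ∧ (∀ x ∉ Metric.ball c (2 * r), b x = 0) ∧
      Integrable (fun x => ‖fderiv ℝ b x‖) ∧
      ∫ x, ‖fderiv ℝ b x‖ ≤ C * r ^ ((N : ℝ) - 1) := by
  let β : ContDiffBump (0 : Vec N) := ⟨1, 2, one_pos, one_lt_two⟩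
  have hβ : ContDiff ℝ 1 β := β.contDiff
  have hβi : Integrable fun x => ‖fderiv ℝ β x‖ :=
    ((hβ.continuous_fderiv one_ne_zero).integrable_of_hasCompactSupport
      (β.hasCompactSupport.fderiv ℝ)).norm
  refine ⟨∫ x, ‖fderiv ℝ β x‖, integral_nonneg fun x => norm_nonneg _, fun c r hr => ?_⟩
  have hfd : (fun x => ‖fderiv ℝ (fun x => β (r⁻¹ • (x - c))) x‖)
      = fun x => r⁻¹ * ‖fderiv ℝ β (r⁻¹ • (x - c))‖ := by
    funext x
    have h1 : HasFDerivAt (fun x : Vec N => r⁻¹ • (x - c)) (r⁻¹ • ContinuousLinearMap.id ℝ _) x :=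
      ((hasFDerivAt_id x).sub_const c).const_smul r⁻¹
    have h2 := ((hβ.differentiable one_ne_zero) (r⁻¹ • (x - c))).hasFDerivAt.comp x h1
    rw [Function.comp_def] at h2
    rw [h2.fderiv, ContinuousLinearMap.comp_smul, ContinuousLinearMap.comp_id, norm_smul, norm_inv,
      Real.norm_of_nonneg hr.le]
  refine ⟨fun x => β (r⁻¹ • (x - c)), hβ.comp (by fun_prop), fun x => β.nonneg,
    fun x => β.le_one, fun x hx => ?_, fun x hx => ?_, ?_, ?_⟩
  · refine β.one_of_mem_closedBall ?_
    rw [mem_closedBall_zero_iff, norm_smul, norm_inv, Real.norm_of_nonneg hr.le,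
      inv_mul_le_iff₀ hr, ← dist_eq_norm]
    simpa [β] using (Metric.mem_ball.1 hx).le
  · refine β.zero_of_le_dist ?_
    rw [dist_zero_right, norm_smul, norm_inv, Real.norm_of_nonneg hr.le, le_inv_mul_iff₀ hr,
      ← dist_eq_norm]
    simpa [β, mul_comm] using hx
  · rw [hfd]
    exact ((hβi.comp_smul (inv_ne_zero hr.ne')).comp_sub_right c).const_mul _
  · rw [hfd, integral_const_mul,
      integral_sub_right_eq_self (fun x => ‖fderiv ℝ β (r⁻¹ • x)‖) c,
      Measure.integral_comp_inv_smul volume (fun x => ‖fderiv ℝ β x‖) r, finrank_euclideanSpace_fin,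
      abs_of_pos (by positivity), smul_eq_mul, ← mul_assoc, mul_comm _ (∫ x, _),
      Real.rpow_sub_one hr.ne', Real.rpow_natCast, div_eq_inv_mul]

/-- Cutoff functions vanishing near a finite union of balls, with controlled total variation. -/
theorem exists_balls_cutoff (N : ℕ) : ∃ C : ℝ, 0 ≤ C ∧
    ∀ (s : Finset ℕ) (c : ℕ → Vec N) (r : ℕ → ℝ), (∀ n ∈ s, 0 < r n) →
    ∃ ζ : Vec N → ℝ, ContDiff ℝ 1 ζ ∧ (∀ x, 0 ≤ ζ x) ∧ (∀ x, ζ x ≤ 1) ∧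
      (∀ n ∈ s, ∀ x ∈ Metric.ball (c n) (r n), ζ x = 0) ∧
      (∀ x, (∀ n ∈ s, x ∉ Metric.ball (c n) (2 * r n)) → ζ x = 1) ∧
      Integrable (fun x => ‖fderiv ℝ ζ x‖) ∧
      ∫ x, ‖fderiv ℝ ζ x‖ ≤ C * ∑ n ∈ s, r n ^ ((N : ℝ) - 1) := by
  obtain ⟨C, hC, hcut⟩ := exists_ball_cutoff N
  refine ⟨C, hC, fun s c r => ?_⟩
  induction s using Finset.induction_on with
  | empty =>
    intro _
    refine ⟨fun _ => 1, contDiff_const, fun _ => zero_le_one, fun _ => le_rfl, by simp, by simp, ?_,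
      ?_⟩ <;> simp
  | insert a s ha ih =>
    intro hr
    obtain ⟨ζ, hζ, hζ0, hζ1, hζz, hζo, hζi, hζb⟩ := ih fun n hn => hr n (Finset.mem_insert_of_mem hn)
    obtain ⟨b, hb, hb0, hb1, hbo, hbz, hbi, hbb⟩ := hcut (c a) (r a) (hr a (Finset.mem_insert_self a s))
    -- Multiplying by `1 - b` kills the new ball; both factors lie in `[0, 1]`, so the total
    -- variations simply add.
    have hsm : ContDiff ℝ 1 fun x => ζ x * (1 - b x) := hζ.mul (contDiff_const.sub hb)
    have hle : ∀ x, ‖fderiv ℝ (fun x => ζ x * (1 - b x)) x‖ ≤ ‖fderiv ℝ ζ x‖ + ‖fderiv ℝ b x‖ := by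
      intro x
      have h1 := (hζ.differentiable one_ne_zero x).hasFDerivAt
      have h2 := ((hb.differentiable one_ne_zero x).hasFDerivAt).const_sub 1
      have h3 : HasFDerivAt (fun x => ζ x * (1 - b x)) _ x := h1.mul h2
      rw [h3.fderiv, add_comm ‖fderiv ℝ ζ x‖]
      refine (norm_add_le _ _).trans (add_le_add ?_ ?_)
      · rw [norm_smul, norm_neg, Real.norm_of_nonneg (hζ0 x)]
        exact mul_le_of_le_one_left (norm_nonneg _) (hζ1 x)
      · rw [norm_smul, Real.norm_of_nonneg (by linarith [hb1 x])]
        exact mul_le_of_le_one_left (norm_nonneg _) (by linarith [hb0 x])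
    have hint : Integrable fun x => ‖fderiv ℝ (fun x => ζ x * (1 - b x)) x‖ :=
      (hζi.add hbi).mono' (hsm.continuous_fderiv one_ne_zero).norm.aestronglyMeasurable
        (Eventually.of_forall fun x => by rw [norm_norm]; exact hle x)
    refine ⟨fun x => ζ x * (1 - b x), hsm, fun x => mul_nonneg (hζ0 x) (by linarith [hb1 x]),
      fun x => mul_le_one₀ (hζ1 x) (by linarith [hb1 x]) (by linarith [hb0 x]), ?_, ?_, hint, ?_⟩
    · intro n hn x hx
      rcases Finset.mem_insert.1 hn with rfl | hn
      · simp [hbo x hx]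
      · simp [hζz n hn x hx]
    · intro x hx
      simp [hζo x fun n hn => hx n (Finset.mem_insert_of_mem hn),
        hbz x (hx a (Finset.mem_insert_self a s))]
    · rw [Finset.sum_insert ha, mul_add, add_comm]
      refine (integral_mono hint (hζi.add hbi) hle).trans ?_
      rw [integral_add' hζi hbi]
      exact add_le_add hζb hbb

/-! ### Global divergence inequality -/

/-- The divergence inequality against test functions vanishing near the singular boundary points. -/
theorem setIntegral_nonpos_of_inward {Ω E : Set (Vec N)} (hΩ : IsCompact Ω) (hE : IsClosed E)
    (hreg : ∀ x ∈ frontier Ω \ E, ∃ n, IsOuterUnitNormal Ω x n)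
    {v : Vec N → Vec N} {g ζ : Vec N → ℝ}
    (hv : ContinuousOn v Ω) (hv1 : ContDiffOn ℝ 1 v (interior Ω)) (hg : ContinuousOn g Ω)
    (hdiv : ∀ x ∈ interior Ω, divergence v x = g x)
    (hin : ∀ x ∈ frontier Ω \ E, ∀ n, IsOuterUnitNormal Ω x n → inner ℝ (v x) n ≤ 0)
    (hζ : ContDiff ℝ 1 ζ) (hζ0 : ∀ x, 0 ≤ ζ x)
    (hζE : ∀ x ∈ frontier Ω ∩ E, x ∉ tsupport ζ) :
    ∫ x in interior Ω, (ζ x * g x + fderiv ℝ ζ x (v x)) ≤ 0 := by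
  have hK : IsCompact (Ω ∩ tsupport ζ) := hΩ.inter_right (isClosed_tsupport ζ)
  have hloc : ∀ p ∈ Ω ∩ tsupport ζ, ∃ ρ > 0, ∀ χ : Vec N → ℝ, ContDiff ℝ 1 χ → (∀ x, 0 ≤ χ x) →
      tsupport χ ⊆ Metric.ball p ρ →
      ∫ x in interior Ω, (χ x * g x + fderiv ℝ χ x (v x)) ≤ 0 := by
    intro p hp
    by_cases hpi : p ∈ interior Ω
    · obtain ⟨ρ, hρ, hball⟩ := Metric.isOpen_iff.1 isOpen_interior p hpi
      refine ⟨ρ, hρ, fun χ hχ _ hχB => le_of_eq ?_⟩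
      have hχc : HasCompactSupport χ := Metric.isCompact_of_isClosed_isBounded (isClosed_tsupport χ)
        (Metric.isBounded_ball.subset hχB)
      have hibp := integral_mul_divergence_add isOpen_interior hχ hχc (hχB.trans hball) hv1
      rw [← setIntegral_eq_integral_of_forall_compl_eq_zero (s := interior Ω)] at hibp
      · rw [← hibp]
        exact setIntegral_congr_fun isOpen_interior.measurableSet fun x hx => by
          simp only [hdiv x hx]
      · intro x hx
        have hx' : x ∉ tsupport χ := fun h => hx (hball (hχB h))
        rw [image_eq_zero_of_notMem_tsupport hx', fderiv_of_notMem_tsupport ℝ hx']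
        simp
    · have hpf : p ∈ frontier Ω := ⟨subset_closure hp.1, hpi⟩
      have hpE : p ∉ E := fun h => hζE p ⟨hpf, h⟩ hp.2
      obtain ⟨n, hn⟩ := hreg p ⟨hpf, hpE⟩
      exact exists_ball_setIntegral_nonpos hΩ hE hv hv1 hg hdiv hin hpE hn
  choose! ρ hρ hneg using hloc
  obtain ⟨b, hbsub, hbfin, hbcov⟩ := hK.elim_finite_subcover_image
    (b := Ω ∩ tsupport ζ) (c := fun p => Metric.ball p (ρ p)) (fun _ _ => Metric.isOpen_ball)
    (fun x hx => mem_iUnion₂.2 ⟨x, hx, Metric.mem_ball_self (hρ x hx)⟩)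
  have := hbfin.fintype
  -- The form is linear in the test function, so a partition of unity on `Ω ∩ supp ζ` reduces the
  -- claim to the local inequalities.
  obtain ⟨f, hf⟩ := SmoothPartitionOfUnity.exists_isSubordinate 𝓘(ℝ, Vec N) hK.isClosed
    (fun i : b => Metric.ball (i : Vec N) (ρ i)) (fun _ => Metric.isOpen_ball)
    (by simpa [iUnion_coe_set] using hbcov)
  have hfs : ∀ i, ContDiff ℝ 1 (f i) := fun i =>
    ((f i).contMDiff.contDiff).of_le (by exact_mod_cast le_top)
  have hχ : ∀ i, ContDiff ℝ 1 fun x => f i x * ζ x := fun i => (hfs i).mul hζ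
  have hsum : ∀ x ∈ Ω, ∑ i, f i x * ζ x = ζ x := by
    intro x hx
    by_cases hxζ : x ∈ tsupport ζ
    · have h1 := f.sum_eq_one (x := x) ⟨hx, hxζ⟩
      rw [finsum_eq_sum_of_fintype] at h1
      rw [← Finset.sum_mul, h1, one_mul]
    · simp [image_eq_zero_of_notMem_tsupport hxζ]
  have hder : ∀ x ∈ interior Ω, ∑ i, fderiv ℝ (fun x => f i x * ζ x) x (v x)
      = fderiv ℝ ζ x (v x) := by
    intro x hx
    have h1 : (fun x => ∑ i, f i x * ζ x) =ᶠ[𝓝 x] ζ := by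
      filter_upwards [isOpen_interior.mem_nhds hx] with z hz using hsum z (interior_subset hz)
    rw [← h1.fderiv_eq, fderiv_fun_sum fun i _ => (hχ i).differentiable one_ne_zero x]
    simp
  have hrw : ∫ x in interior Ω, (ζ x * g x + fderiv ℝ ζ x (v x))
      = ∑ i, ∫ x in interior Ω, (f i x * ζ x * g x
        + fderiv ℝ (fun x => f i x * ζ x) x (v x)) := by
    rw [← integral_finsetSum _ fun i _ => by
      exact integrableOn_divergence_form hΩ (hχ i) hg hv]
    refine setIntegral_congr_fun isOpen_interior.measurableSet fun x hx => ?_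
    simp only [Finset.sum_add_distrib]
    rw [hder x hx, ← Finset.sum_mul, hsum x (interior_subset hx)]
  rw [hrw]
  refine Finset.sum_nonpos fun i _ => ?_
  refine hneg i (hbsub i.2) _ (hχ i) (fun x => mul_nonneg (f.nonneg i x) (hζ0 x)) ?_
  exact (closure_mono (Function.support_mul_subset_left (f i) ζ)).trans (hf i)

/-- A field on a compact region which does not point outward at the regular boundary points and
whose divergence is nonnegative has zero divergence, provided that the singular part of the boundary
is negligible. -/
theorem eq_zero_of_divergence_nonneg {Ω E : Set (Vec N)} (hN : 1 ≤ N) (hΩ : IsCompact Ω)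
    (hE : IsClosed E) (hE0 : μH[(N : ℝ) - 1] E = 0)
    (hreg : ∀ x ∈ frontier Ω \ E, ∃ n, IsOuterUnitNormal Ω x n)
    {v : Vec N → Vec N} {g : Vec N → ℝ}
    (hv : ContinuousOn v Ω) (hv1 : ContDiffOn ℝ 1 v (interior Ω)) (hg : ContinuousOn g Ω)
    (hg0 : ∀ x ∈ interior Ω, 0 ≤ g x) (hdiv : ∀ x ∈ interior Ω, divergence v x = g x)
    (hin : ∀ x ∈ frontier Ω \ E, ∀ n, IsOuterUnitNormal Ω x n → inner ℝ (v x) n ≤ 0) :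
    ∀ x ∈ interior Ω, g x = 0 := by
  intro q hq
  by_contra hne
  have hgq : 0 < g q := lt_of_le_of_ne (hg0 q hq) (Ne.symm hne)
  have hgc : ContinuousAt g q := (hg.mono interior_subset).continuousAt (isOpen_interior.mem_nhds hq)
  obtain ⟨R, hR, hball⟩ := Metric.eventually_nhds_iff_ball.1
    (Filter.Eventually.and (isOpen_interior.mem_nhds hq)
      (hgc.eventually (lt_mem_nhds (half_lt_self hgq))))
  obtain ⟨M, hM⟩ := hΩ.exists_bound_of_continuousOn hv
  have hM0 : 0 ≤ M := (norm_nonneg _).trans (hM q (interior_subset hq))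
  obtain ⟨C, hC, hcut⟩ := exists_balls_cutoff N
  set V := volume.real (Metric.ball q (R / 2)) with hV
  have hV0 : 0 < V := ENNReal.toReal_pos (Metric.measure_ball_pos volume q (by positivity)).ne'
    measure_ball_lt_top.ne
  have hNd : (0 : ℝ) ≤ (N : ℝ) - 1 := by
    have : (1 : ℝ) ≤ N := by exact_mod_cast hN
    linarith
  -- This bound on the content makes the flux error `M C ε` smaller than `g q / 2 * V`; the `+ 1`
  -- guards against `M C = 0`.
  have hε : 0 < g q / 2 * V / (M * C + 1) := by positivity
  have hfc : IsCompact (frontier Ω ∩ E) :=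
    (hΩ.of_isClosed_subset isClosed_frontier hΩ.isClosed.frontier_subset).inter_right hE
  obtain ⟨s, c, r, hcr, hcov, hsum⟩ := exists_finite_ball_cover hfc hNd
    (measure_mono_null inter_subset_right hE0) hε (show 0 < R / 8 by positivity)
  obtain ⟨ζ, hζ, hζ0, hζ1, hζz, hζo, hζi, hζb⟩ := hcut s c r fun n hn => (hcr n hn).2.1
  have hT := setIntegral_nonpos_of_inward hΩ hE hreg hv hv1 hg hdiv hin hζ hζ0 (fun x hx => by
    obtain ⟨n, hn, hxn⟩ := mem_iUnion₂.1 (hcov hx)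
    refine notMem_tsupport_iff_eventuallyEq.2 ?_
    filter_upwards [Metric.isOpen_ball.mem_nhds hxn] with z hz using hζz n hn z hz)
  have hi1 : IntegrableOn (fun x => ζ x * g x) (interior Ω) :=
    ((hζ.continuous.continuousOn.mul hg).integrableOn_compact hΩ).mono_set interior_subset
  have hi2 : IntegrableOn (fun x => fderiv ℝ ζ x (v x)) (interior Ω) :=
    (((hζ.continuous_fderiv one_ne_zero).continuousOn.clm_apply hv).integrableOn_compact hΩ).mono_set
      interior_subset
  rw [integral_add hi1 hi2] at hT
  have hsub : Metric.ball q (R / 2) ⊆ Metric.ball q R := Metric.ball_subset_ball (by linarith)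
  -- The balls have doubled radius below `R / 4` and centres on the frontier, while `ball q R` is
  -- interior; so none of them reaches `ball q (R / 2)`.
  have hone : ∀ x ∈ Metric.ball q (R / 2), ζ x = 1 := by
    intro x hx
    refine hζo x fun n hn hxn => ?_
    have h1 : c n ∈ Metric.ball q R := by
      have := dist_triangle (c n) x q
      rw [dist_comm (c n) x] at this
      rw [Metric.mem_ball] at hx hxn ⊢
      linarith [(hcr n hn).2.2]
    exact (hcr n hn).1.1.2 (hball _ h1).1
  have hlow : g q / 2 * V ≤ ∫ x in interior Ω, ζ x * g x := by
    calc g q / 2 * V = ∫ _ in Metric.ball q (R / 2), g q / 2 := by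
          rw [setIntegral_const, smul_eq_mul, mul_comm]
      _ ≤ ∫ x in Metric.ball q (R / 2), ζ x * g x := by
          refine setIntegral_mono_on (integrableOn_const measure_ball_lt_top.ne)
            (hi1.mono_set fun x hx => (hball x (hsub hx)).1) measurableSet_ball fun x hx => ?_
          rw [hone x hx, one_mul]
          exact (hball x (hsub hx)).2.le
      _ ≤ ∫ x in interior Ω, ζ x * g x := by
          refine setIntegral_mono_set hi1 ?_ (LE.le.eventuallyLE fun x hx => (hball x (hsub hx)).1)
          exact (ae_restrict_iff' isOpen_interior.measurableSet).2
            (Eventually.of_forall fun x hx => mul_nonneg (hζ0 x) (hg0 x hx))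
  have hup : -∫ x in interior Ω, fderiv ℝ ζ x (v x) ≤ M * (C * ∑ n ∈ s, r n ^ ((N : ℝ) - 1)) := by
    calc -∫ x in interior Ω, fderiv ℝ ζ x (v x) ≤ ∫ x in interior Ω, M * ‖fderiv ℝ ζ x‖ := by
          rw [← integral_neg]
          refine setIntegral_mono_on hi2.neg (hζi.const_mul M).integrableOn
            isOpen_interior.measurableSet fun x hx => ?_
          have h1 := (fderiv ℝ ζ x).le_opNorm (v x)
          have h2 := neg_le_abs (fderiv ℝ ζ x (v x))
          rw [Real.norm_eq_abs] at h1
          have h3 := mul_le_mul_of_nonneg_left (hM x (interior_subset hx)) (norm_nonneg (fderiv ℝ ζ x))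
          linarith
      _ ≤ ∫ x, M * ‖fderiv ℝ ζ x‖ := setIntegral_le_integral (hζi.const_mul M)
          (Eventually.of_forall fun x => mul_nonneg hM0 (norm_nonneg _))
      _ ≤ M * (C * ∑ n ∈ s, r n ^ ((N : ℝ) - 1)) := by
          rw [integral_const_mul]
          exact mul_le_mul_of_nonneg_left hζb hM0
  have hMC : 0 ≤ M * C := mul_nonneg hM0 hC
  rw [lt_div_iff₀ (by positivity)] at hsum
  have hS : 0 ≤ ∑ n ∈ s, r n ^ ((N : ℝ) - 1) :=
    Finset.sum_nonneg fun n hn => Real.rpow_nonneg (hcr n hn).2.1.le _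
  nlinarith

/-! ### Tensor algebra and the trace pairing -/

set_option maxSynthPendingDepth 3

theorem tensor_apply (a b x : Vec N) : tensor a b x = inner ℝ b x • a :=
  InnerProductSpace.rankOne_apply ..

theorem inner_basisVec (j : Fin N) (x : Vec N) : inner ℝ (basisVec j) x = x j := by
  simp [basisVec, EuclideanSpace.inner_single_left]

theorem sum_smul_basisVec_apply (c : Fin N → ℝ) (k : Fin N) :
    (∑ i, c i • basisVec i : Vec N) k = c k := by
  rw [← inner_basisVec, inner_sum, Finset.sum_eq_single k]
  · rw [inner_smul_right, inner_basisVec]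
    simp [basisVec]
  · intro i _ hik
    rw [inner_smul_right, inner_basisVec]
    simp [basisVec, hik.symm]
  · simp

theorem basisVec_apply_self (j : Fin N) : (basisVec j : Vec N) j = 1 := by simp [basisVec]

theorem sum_tensor_basisVec (A : Lin N) : ∑ j, tensor (A (basisVec j)) (basisVec j) = A := by
  ext1 x
  conv_rhs => rw [← sum_apply_smul_basisVec x, map_sum]
  rw [sum_apply]
  exact Finset.sum_congr rfl fun j _ => by rw [tensor_apply, inner_basisVec, map_smul]

theorem tensor_eq_sum_right (a b : Vec N) : tensor a b = ∑ j, b j • tensor a (basisVec j) := by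
  ext1 x
  conv_lhs => rw [tensor_apply, ← sum_apply_smul_basisVec b, sum_inner, Finset.sum_smul]
  rw [sum_apply]
  refine Finset.sum_congr rfl fun j _ => ?_
  rw [inner_smul_left, smul_apply, tensor_apply, smul_smul, conj_trivial]

theorem tensor_eq_sum_left (a b : Vec N) : tensor a b = ∑ i, a i • tensor (basisVec i) b := by
  ext1 x
  conv_lhs => rw [tensor_apply, ← sum_apply_smul_basisVec a, Finset.smul_sum]
  rw [sum_apply]
  refine Finset.sum_congr rfl fun j _ => ?_
  rw [smul_apply, tensor_apply, smul_comm]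

/-- The map `a ↦ a ⊗ b`. -/
noncomputable def tensorLeft (b : Vec N) : Vec N →L[ℝ] Lin N :=
  (InnerProductSpace.rankOne ℝ : Vec N →L[ℝ] Vec N →L⋆[ℝ] Lin N).flip b

theorem tensorLeft_apply (a b : Vec N) : tensorLeft b a = tensor a b := rfl

/-- The tensor representing a linear functional with respect to the trace inner product. -/
noncomputable def dualTensor : (Lin N →L[ℝ] ℝ) →L[ℝ] Lin N :=
  ∑ i, ∑ j, (ContinuousLinearMap.apply ℝ ℝ (tensor (basisVec i) (basisVec j) : Lin N)).smulRight
    (tensor (basisVec i) (basisVec j))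

theorem piola_eq_dualTensor (W : Lin N → ℝ) (F : Lin N) :
    piola W F = dualTensor (fderiv ℝ W F) := by
  simp [piola, dualTensor, sum_apply]

/-- This passes between tractions `S n` and the functional `DW(F)` on rank-one tensors, so that the
later computations never need matrix entries. -/
theorem inner_dualTensor_apply (ℓ : Lin N →L[ℝ] ℝ) (a b : Vec N) :
    inner ℝ (dualTensor ℓ b) a = ℓ (tensor a b) := by
  rw [tensor_eq_sum_left, map_sum, dualTensor, sum_apply, sum_apply, sum_inner]
  refine Finset.sum_congr rfl fun i _ => ?_
  rw [tensor_eq_sum_right, map_smul, map_sum, sum_apply, sum_apply, sum_inner, smul_eq_mul,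
    Finset.mul_sum]
  refine Finset.sum_congr rfl fun j _ => ?_
  rw [ContinuousLinearMap.smulRight_apply, ContinuousLinearMap.apply_apply, smul_apply,
    tensor_apply, inner_smul_left, inner_smul_left, inner_basisVec, inner_basisVec, map_smul]
  simp only [conj_trivial, smul_eq_mul]
  ring

theorem inner_piola_apply (W : Lin N → ℝ) (F : Lin N) (a b : Vec N) :
    inner ℝ (piola W F b) a = fderiv ℝ W F (tensor a b) := by
  rw [piola_eq_dualTensor, inner_dualTensor_apply]

theorem isOpen_linPos : IsOpen (LinPos N) :=
  isOpen_lt continuous_const ContinuousLinearMap.continuous_det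

/-! ### The energy flux and its divergence -/

/-- The field `(W(F) - W(F₀) - S(F₀)·(F - F₀)) x + (S(F) - S(F₀))ᵀ (y - F x)` built from a deformation
`y` with gradient `F`. -/
noncomputable def energyFlux (W : Lin N → ℝ) (F₀ : Lin N) (F : Vec N → Lin N) (y : Vec N → Vec N)
    (z : Vec N) : Vec N :=
  (W (F z) - W F₀ - fderiv ℝ W F₀ (F z - F₀)) • z +
    ∑ j, ((fderiv ℝ W (F z) - fderiv ℝ W F₀) (tensorLeft (basisVec j) (y z - F z z))) • basisVec j

theorem inner_energyFlux (W : Lin N → ℝ) (F₀ : Lin N) (F : Vec N → Lin N) (y : Vec N → Vec N)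
    (z n : Vec N) :
    inner ℝ (energyFlux W F₀ F y z) n =
      (W (F z) - W F₀ - fderiv ℝ W F₀ (F z - F₀)) * inner ℝ z n +
        (fderiv ℝ W (F z) - fderiv ℝ W F₀) (tensor (y z - F z z) n) := by
  rw [energyFlux, inner_add_left, inner_smul_left, conj_trivial, sum_inner, tensor_eq_sum_right,
    map_sum]
  congr 1
  refine Finset.sum_congr rfl fun j _ => ?_
  rw [inner_smul_left, conj_trivial, inner_basisVec, map_smul, tensorLeft_apply, smul_eq_mul, mul_comm]

theorem continuousOn_energyFlux {W : Lin N → ℝ} (hW : ContDiffOn ℝ 2 W (LinPos N)) (F₀ : Lin N)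
    {F : Vec N → Lin N} {y : Vec N → Vec N} {s : Set (Vec N)} (hF : ContinuousOn F s)
    (hFs : MapsTo F s (LinPos N)) (hy : ContinuousOn y s) :
    ContinuousOn (energyFlux W F₀ F y) s := by
  have h1 : ContinuousOn (fun z => W (F z)) s := hW.continuousOn.comp hF hFs
  have h2 : ContinuousOn (fun z => fderiv ℝ W (F z)) s :=
    (hW.continuousOn_fderiv_of_isOpen isOpen_linPos one_le_two).comp hF hFs
  have h3 : ContinuousOn (fun z => F z z) s := hF.clm_apply continuousOn_id
  unfold energyFlux
  refine ContinuousOn.add ?_ (continuousOn_finsetSum _ fun j _ => ?_)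
  · exact ((h1.sub continuousOn_const).sub
      (continuousOn_const.clm_apply (hF.sub continuousOn_const))).smul continuousOn_id
  · exact ((h2.sub continuousOn_const).clm_apply
      ((tensorLeft (basisVec j)).continuous.comp_continuousOn (hy.sub h3))).smul continuousOn_const

theorem contDiffOn_energyFlux {W : Lin N → ℝ} (hW : ContDiffOn ℝ 2 W (LinPos N)) (F₀ : Lin N)
    {F : Vec N → Lin N} {y : Vec N → Vec N} {s : Set (Vec N)} (hF : ContDiffOn ℝ 1 F s)
    (hFs : MapsTo F s (LinPos N)) (hy : ContDiffOn ℝ 1 y s) :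
    ContDiffOn ℝ 1 (energyFlux W F₀ F y) s := by
  have h1 : ContDiffOn ℝ 1 (fun z => W (F z)) s := (hW.of_le one_le_two).comp hF hFs
  have h2 : ContDiffOn ℝ 1 (fun z => fderiv ℝ W (F z)) s :=
    (hW.fderiv_of_isOpen isOpen_linPos (by norm_num)).comp hF hFs
  have h3 : ContDiffOn ℝ 1 (fun z => F z z) s := hF.clm_apply contDiffOn_id
  unfold energyFlux
  refine ContDiffOn.add ?_ (ContDiffOn.sum fun j _ => ?_)
  · exact ((h1.sub contDiffOn_const).sub
      (contDiffOn_const.clm_apply (hF.sub contDiffOn_const))).smul contDiffOn_id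
  · exact ((h2.sub contDiffOn_const).clm_apply
      ((tensorLeft (basisVec j)).contDiff.comp_contDiffOn (hy.sub h3))).smul contDiffOn_const

/-- The equilibrium equation paired with a fixed vector `w`, rewritten for the stress as a linear
functional. -/
theorem sum_fderiv_tensor_eq_zero {H : Vec N → Lin N →L[ℝ] ℝ}
    {H' : Vec N →L[ℝ] Lin N →L[ℝ] ℝ} {x : Vec N} (hH : HasFDerivAt H H' x)
    (h0 : tensorDiv (fun z => dualTensor (H z)) x = 0) (w : Vec N) :
    ∑ j, H' (basisVec j) (tensor w (basisVec j)) = 0 := by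
  have h1 : HasFDerivAt (fun z => dualTensor (H z)) (dualTensor.comp H') x := by
    have := dualTensor.hasFDerivAt.comp x hH
    exact this
  have h2 : inner ℝ (tensorDiv (fun z => dualTensor (H z)) x) w = 0 := by rw [h0, inner_zero_left]
  rw [tensorDiv, h1.fderiv, sum_inner] at h2
  rw [← h2]
  exact Finset.sum_congr rfl fun j _ => (inner_dualTensor_apply _ _ _).symm

theorem divergence_eq_of_hasFDerivAt {v : Vec N → Vec N} {V : Lin N} {x : Vec N}
    (h : HasFDerivAt v V x) : divergence v x = ∑ j, (V (basisVec j)) j := by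
  rw [divergence, h.fderiv]

/-- Let `ℓ = DW(F) - DW(F₀)`, and let `F'` be the derivative of `F = ∇y`. The term `e x` contributes
`N e + ℓ(F' x)`. In the other term, the derivative falling on the stress gives zero by equilibrium,
and the one falling on `y - F x` gives `-ℓ(F' x)`, so the two cancel. -/
theorem divergence_energyFlux {W : Lin N → ℝ} (hW : ContDiffOn ℝ 2 W (LinPos N)) (F₀ : Lin N)
    {y : Vec N → Vec N} {x : Vec N} (hy : ContDiffAt ℝ 2 y x) (hx : fderiv ℝ y x ∈ LinPos N)
    (hdiv : tensorDiv (fun z => piola W (fderiv ℝ y z)) x = 0) :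
    divergence (energyFlux W F₀ (fderiv ℝ y) y) x =
      N * (W (fderiv ℝ y x) - W F₀ - fderiv ℝ W F₀ (fderiv ℝ y x - F₀)) := by
  have hF : HasFDerivAt (fderiv ℝ y) (fderiv ℝ (fderiv ℝ y) x) x :=
    ((hy.fderiv_right (m := 1) (by norm_num)).differentiableAt one_ne_zero).hasFDerivAt
  have hyd : HasFDerivAt y (fderiv ℝ y x) x := (hy.differentiableAt two_ne_zero).hasFDerivAt
  have hWx : ContDiffAt ℝ 2 W (fderiv ℝ y x) := hW.contDiffAt (isOpen_linPos.mem_nhds hx)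
  have hWd : HasFDerivAt W (fderiv ℝ W (fderiv ℝ y x)) (fderiv ℝ y x) :=
    (hWx.differentiableAt two_ne_zero).hasFDerivAt
  have hH₀ : HasFDerivAt (fderiv ℝ W) (fderiv ℝ (fderiv ℝ W) (fderiv ℝ y x)) (fderiv ℝ y x) :=
    ((hWx.fderiv_right (m := 1) (by norm_num)).differentiableAt one_ne_zero).hasFDerivAt
  have hsymm : ∀ a b, fderiv ℝ (fderiv ℝ y) x a b = fderiv ℝ (fderiv ℝ y) x b a := fun a b =>
    (hy.isSymmSndFDerivAt (by simp)) a b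
  set F' := fderiv ℝ (fderiv ℝ y) x with hF'
  set F := fderiv ℝ y x with hFx
  set H' := (fderiv ℝ (fderiv ℝ W) F).comp F' with hH'
  have hH : HasFDerivAt (fun z => fderiv ℝ W (fderiv ℝ y z)) H' x := by
    have := HasFDerivAt.comp x hH₀ hF
    exact this
  have hzero := sum_fderiv_tensor_eq_zero hH (by simpa only [piola_eq_dualTensor] using hdiv)
    (y x - F x)
  set ℓ := fderiv ℝ W F - fderiv ℝ W F₀ with hℓ
  have he : HasFDerivAt (fun z => W (fderiv ℝ y z) - W F₀ - fderiv ℝ W F₀ (fderiv ℝ y z - F₀))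
      (ℓ.comp F') x := by
    have h1 : HasFDerivAt (fun z => W (fderiv ℝ y z)) ((fderiv ℝ W F).comp F') x := hWd.comp x hF
    have h2 : HasFDerivAt (fun z => fderiv ℝ W F₀ (fderiv ℝ y z - F₀))
        ((fderiv ℝ W F₀).comp F') x :=
      (fderiv ℝ W F₀).hasFDerivAt.comp x (hF.sub_const F₀)
    exact (h1.sub_const _).sub h2
  -- Differentiating `y - F z` produces `F` twice with opposite signs; only the derivative of `F`
  -- survives.
  have hw : HasFDerivAt (fun z => y z - fderiv ℝ y z z) (-(F'.flip x)) x := by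
    have h1 := hyd.sub (hF.clm_apply (hasFDerivAt_id x))
    refine h1.congr_fderiv ?_
    ext1 z
    simp [← hFx]
  have hsum : HasFDerivAt (energyFlux W F₀ (fderiv ℝ y) y) _ x :=
    (he.smul (hasFDerivAt_id x)).add (HasFDerivAt.fun_sum fun (j : Fin N) _ =>
      ((hH.sub_const (fderiv ℝ W F₀)).clm_apply
        ((tensorLeft (basisVec j)).hasFDerivAt.comp x hw)).smul_const (basisVec j))
  rw [divergence_eq_of_hasFDerivAt hsum]
  have hlast : ∑ j, ℓ (tensor (F' x (basisVec j)) (basisVec j)) = ℓ (F' x) := by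
    rw [← map_sum, sum_tensor_basisVec]
  have hfirst : ∑ j, ℓ (F' (basisVec j)) * x j = ℓ (F' x) := by
    conv_rhs => rw [← sum_apply_smul_basisVec x]
    simp [mul_comm]
  -- Symmetry of the second derivative turns `(F' e_j) x` into `(F' x) e_j`.
  have hterm : ∀ j : Fin N, ℓ (tensor (-(F' (basisVec j)) x) (basisVec j))
      = -ℓ (tensor (F' x (basisVec j)) (basisVec j)) := fun j => by
    rw [← tensorLeft_apply, map_neg, map_neg, tensorLeft_apply, hsymm]
  simp only [add_apply, sum_apply, ContinuousLinearMap.smulRight_apply, smul_apply, neg_apply,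
    ContinuousLinearMap.comp_apply, ContinuousLinearMap.flip_apply, ContinuousLinearMap.id_apply,
    PiLp.add_apply, PiLp.smul_apply, smul_eq_mul, sum_smul_basisVec_apply, basisVec_apply_self,
    Function.comp_apply, id_eq, mul_one, ← hFx, ← hℓ]
  simp only [hterm, tensorLeft_apply, Finset.sum_add_distrib, Finset.sum_neg_distrib, hzero, hlast,
    hfirst, Finset.sum_const, Finset.card_univ, Fintype.card_fin, nsmul_eq_mul]
  ring

/-! ### Hadamard's compatibility condition -/

/-- Mean value inequality along a segment, the end point of which may lie on the boundary. -/
theorem norm_image_sub_le_of_lineMap_mem {O K : Set (Vec N)} (hO : IsOpen O) {f : Vec N → Vec N}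
    (hf : ContinuousOn f K) (hd : DifferentiableOn ℝ f O) {C : ℝ} {a b : Vec N}
    (hK : ∀ τ ∈ Icc (0 : ℝ) 1, AffineMap.lineMap a b τ ∈ K)
    (hmem : ∀ τ ∈ Ico (0 : ℝ) 1, AffineMap.lineMap a b τ ∈ O)
    (hC : ∀ τ ∈ Ico (0 : ℝ) 1, ‖fderiv ℝ f (AffineMap.lineMap a b τ)‖ ≤ C) :
    ‖f b - f a‖ ≤ C * ‖b - a‖ := by
  have h1 := norm_image_sub_le_of_norm_deriv_right_le_segment (a := (0 : ℝ)) (b := 1)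
    (f := fun τ => f (AffineMap.lineMap a b τ)) (C := C * ‖b - a‖)
    (f' := fun τ => fderiv ℝ f (AffineMap.lineMap a b τ) (b - a))
    (hf.comp AffineMap.lineMap_continuous.continuousOn hK) (fun τ hτ => ?_) (fun τ hτ => ?_)
    1 (right_mem_Icc.2 zero_le_one)
  · simpa using h1
  · have h2 := (hd.differentiableAt (hO.mem_nhds (hmem τ hτ))).hasFDerivAt
    have h3 := h2.comp_hasDerivAt τ (AffineMap.hasDerivAt_lineMap (a := a) (b := b))
    exact h3.hasDerivWithinAt
  · refine (ContinuousLinearMap.le_opNorm _ _).trans ?_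
    exact mul_le_mul_of_nonneg_right (hC τ hτ) (norm_nonneg _)

set_option maxHeartbeats 1000000 in
/-- If a map vanishes on the boundary near a regular point, its gradient there vanishes on tangent
vectors. -/
theorem apply_eq_zero_of_tangent {Ω : Set (Vec N)} {p n : Vec N} (hn : IsOuterUnitNormal Ω p n)
    {u : Vec N → Vec N} (hu : ContinuousOn u Ω) (hud : DifferentiableOn ℝ u (interior Ω)) {A : Lin N}
    (hA : Tendsto (fderiv ℝ u) (𝓝[interior Ω] p) (𝓝 A)) (hp : p ∈ frontier Ω)
    (h0 : ∀ᶠ x in 𝓝[frontier Ω] p, u x = 0) {t : Vec N} (ht : inner ℝ n t = 0) : A t = 0 := by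
  have hn1 : ‖n‖ = 1 := hn.1
  obtain ⟨ρ, hρ, -, φ, hφp, hgrad, hφ, -, hmem, hint, hfr, hder, -⟩ :=
    hn.exists_ball isClosed_empty (notMem_empty p)
  have hup : u p = 0 := h0.self_of_nhdsWithin hp
  set T := ‖t‖ with hT
  have hT0 : 0 ≤ T := norm_nonneg t
  -- A straight segment between boundary points may leave `Ω`, so the path goes from `p` inward by
  -- `ε s`, parallel to `t` for parameter length `s`, then along `n` to a boundary point `X l s`.
  -- There `u - A` has gradient at most `ε`, and `u` vanishes at both ends, so `l A n + s A t` is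
  -- small; since `|l| ≤ ε s`, dividing by `s` bounds `A t`.
  have key : ∀ ε : ℝ, 0 < ε → ε < 1 → ‖A t‖ ≤ ε * (3 + T + ‖A‖) := by
    intro ε hε hε1
    -- This slope tolerance keeps the deviation of `φ` from its linear part below `ε s` along the
    -- path.
    have hκ : 0 < ε / (2 * (1 + T)) := by positivity
    have hκT : ε / (2 * (1 + T)) * (1 + T) = ε / 2 := by field_simp
    set κ := ε / (2 * (1 + T)) with hκdef
    have hκ1 : κ < 1 := by nlinarith
    have e1 : ∀ᶠ x in 𝓝 p, |φ x - inner ℝ n (x - p)| ≤ κ * ‖x - p‖ := by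
      have := hgrad.hasFDerivAt.isLittleO.def hκ
      filter_upwards [this] with x hx
      simpa [hφp] using hx
    have e2 : ∀ᶠ x in 𝓝 p, x ∈ interior Ω → ‖fderiv ℝ u x - A‖ ≤ ε := by
      have := hA.eventually (Metric.closedBall_mem_nhds A hε)
      filter_upwards [eventually_nhdsWithin_iff.1 this] with x hx hxi
      simpa [dist_eq_norm] using hx hxi
    have e3 := eventually_nhdsWithin_iff.1 h0
    obtain ⟨r, hr, hball⟩ := Metric.eventually_nhds_iff_ball.1
      (Filter.Eventually.and (Metric.ball_mem_nhds p hρ) (e1.and (e2.and e3)))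
    set s := r / (2 * (1 + T)) with hs
    have hs0 : 0 < s := by positivity
    have hsr : s * (1 + T) < r := by
      have : s * (1 + T) = r / 2 := by rw [hs]; field_simp
      linarith
    set X : ℝ → ℝ → Vec N := fun a b => p + (a • n + b • t) with hX
    have hXn : ∀ a b : ℝ, 0 ≤ b → ‖X a b - p‖ ≤ |a| + b * T := by
      intro a b hb
      rw [hX]
      simp only [add_sub_cancel_left]
      refine (norm_add_le _ _).trans ?_
      rw [norm_smul, norm_smul, hn1, Real.norm_eq_abs, Real.norm_of_nonneg hb, mul_one]
    have hXi : ∀ a b : ℝ, inner ℝ n (X a b - p) = a := by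
      intro a b
      rw [hX]
      simp only [add_sub_cancel_left]
      rw [inner_add_right, inner_smul_right, inner_smul_right, ht, real_inner_self_eq_norm_sq, hn1]
      ring
    have hXball : ∀ a b : ℝ, |a| ≤ ε * s → 0 ≤ b → b ≤ s → X a b ∈ Metric.ball p r := by
      intro a b ha hb hbs
      rw [mem_ball_iff_norm]
      have := hXn a b hb
      nlinarith [mul_le_mul_of_nonneg_right hbs hT0]
    have hXφ : ∀ a b : ℝ, |a| ≤ ε * s → 0 ≤ b → b ≤ s → |φ (X a b) - a| ≤ κ * (|a| + b * T) := by
      intro a b ha hb hbs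
      have := (hball _ (hXball a b ha hb hbs)).2.1
      rw [hXi] at this
      exact this.trans (mul_le_mul_of_nonneg_left (hXn a b hb) hκ.le)
    have hline : ∀ a b a' b' τ : ℝ, AffineMap.lineMap (X a b) (X a' b') τ
        = X (a + τ * (a' - a)) (b + τ * (b' - b)) := by
      intro a b a' b' τ
      simp only [hX, AffineMap.lineMap_apply, vsub_eq_sub, vadd_eq_add]
      module
    have hεs : 0 < ε * s := mul_pos hε hs0
    have hκs : κ * (ε * s + s * T) < ε * s := by
      have h1 : κ * (ε * s + s * T) ≤ κ * (1 + T) * s := by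
        have : κ * (ε * s) ≤ κ * (1 * s) := by gcongr
        nlinarith
      rw [hκT] at h1
      nlinarith
    have hdown : ∀ b, 0 ≤ b → b ≤ s → X (-(ε * s)) b ∈ interior Ω := by
      intro b hb hbs
      have habs : |-(ε * s)| = ε * s := by rw [abs_neg, abs_of_pos hεs]
      rw [hint _ (hball _ (hXball _ b habs.le hb hbs)).1]
      have h1 := (abs_le.1 (hXφ (-(ε * s)) b habs.le hb hbs)).2
      rw [habs] at h1
      have h2 : κ * (ε * s + b * T) ≤ κ * (ε * s + s * T) := by gcongr
      linarith
    -- the boundary point above `X (-ε s) s`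
    obtain ⟨l, hl, hlz, hlneg⟩ : ∃ l, |l| ≤ ε * s ∧ φ (X l s) = 0 ∧
        ∀ a, |a| ≤ ε * s → a < l → φ (X a s) < 0 := by
      have hXd : ∀ a, HasDerivAt (fun a => φ (X a s)) (fderiv ℝ φ (X a s) n) a := by
        intro a
        have h1 : HasDerivAt (fun a => X a s) n a := by
          have := (((hasDerivAt_id a).smul_const n).add_const (s • t)).const_add p
          rw [one_smul] at this
          exact this
        have h2 := ((hφ.differentiable one_ne_zero) (X a s)).hasFDerivAt.comp_hasDerivAt a h1
        exact h2
      have hcont : ContinuousOn (fun a => φ (X a s)) (Icc (-(ε * s)) (ε * s)) := fun a _ =>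
        (hXd a).continuousAt.continuousWithinAt
      have hmono : StrictMonoOn (fun a => φ (X a s)) (Icc (-(ε * s)) (ε * s)) := by
        refine strictMonoOn_of_deriv_pos (convex_Icc _ _) hcont fun a ha => ?_
        rw [interior_Icc] at ha
        rw [(hXd a).deriv]
        have := hder _ (hball _ (hXball a s (abs_le.2 ⟨ha.1.le, ha.2.le⟩) hs0.le le_rfl)).1
        linarith
      have hlo : φ (X (-(ε * s)) s) ≤ 0 := by
        have habs : |-(ε * s)| = ε * s := by rw [abs_neg, abs_of_pos hεs]
        exact ((hint _ (hball _ (hXball _ s habs.le hs0.le le_rfl)).1).1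
          (hdown s hs0.le le_rfl)).le
      have hhi : 0 ≤ φ (X (ε * s) s) := by
        have h1 := (abs_le.1 (hXφ (ε * s) s (abs_of_pos hεs).le hs0.le le_rfl)).1
        rw [abs_of_pos hεs] at h1
        linarith
      -- `φ` changes sign across the normal segment and increases along it, so it has a zero `l`
      -- with `φ < 0` below.
      obtain ⟨l, hl, hlz⟩ := intermediate_value_Icc (by linarith) hcont ⟨hlo, hhi⟩
      refine ⟨l, abs_le.2 hl, hlz, fun a ha hal => ?_⟩
      have := hmono (abs_le.1 ha) hl hal
      simpa only [hlz] using this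
    have hhball : X l s ∈ Metric.ball p r := hXball l s hl hs0.le le_rfl
    have hhfr : X l s ∈ frontier Ω := (hfr _ (hball _ hhball).1).2 hlz
    have huh : u (X l s) = 0 := (hball _ hhball).2.2.2 hhfr
    set f : Vec N → Vec N := fun x => u x - A x with hf
    have hfc : ContinuousOn f Ω := hu.sub A.continuous.continuousOn
    have hfd : DifferentiableOn ℝ f (interior Ω) := hud.sub A.differentiable.differentiableOn
    have hfb : ∀ x ∈ interior Ω, x ∈ Metric.ball p r → ‖fderiv ℝ f x‖ ≤ ε := by
      intro x hx hxb
      have h1 := (hud.differentiableAt (isOpen_interior.mem_nhds hx)).hasFDerivAt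
      have h2 : HasFDerivAt f (fderiv ℝ u x - A) x := h1.sub A.hasFDerivAt
      rw [h2.fderiv]
      exact (hball x hxb).2.2.1 hx
    have hseg : ∀ a b a' b' : ℝ, |a| ≤ ε * s → 0 ≤ b → b ≤ s → |a'| ≤ ε * s → 0 ≤ b' → b' ≤ s →
        X a' b' ∈ Ω →
        (∀ τ ∈ Ico (0 : ℝ) 1, X (a + τ * (a' - a)) (b + τ * (b' - b)) ∈ interior Ω) →
        ‖f (X a' b') - f (X a b)‖ ≤ ε * (|a' - a| + |b' - b| * T) := by
      intro a b a' b' ha hb hbs ha' hb' hbs' hend hin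
      have hbl : ∀ τ ∈ Icc (0 : ℝ) 1, AffineMap.lineMap (X a b) (X a' b') τ ∈ Metric.ball p r :=
        fun τ hτ => (convex_ball p r).lineMap_mem (hXball a b ha hb hbs) (hXball a' b' ha' hb' hbs') hτ
      have h1 := norm_image_sub_le_of_lineMap_mem isOpen_interior hfc hfd (C := ε) (a := X a b)
        (b := X a' b') (fun τ hτ => ?_) (fun τ hτ => by rw [hline]; exact hin τ hτ)
        (fun τ hτ => hfb _ (by rw [hline]; exact hin τ hτ) (hbl τ (Ico_subset_Icc_self hτ)))
      · refine h1.trans (mul_le_mul_of_nonneg_left ?_ hε.le)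
        have h2 : X a' b' - X a b = (a' - a) • n + (b' - b) • t := by
          simp only [hX]
          module
        rw [h2]
        refine (norm_add_le _ _).trans ?_
        rw [norm_smul, norm_smul, hn1, Real.norm_eq_abs, Real.norm_eq_abs, mul_one]
      · rcases eq_or_lt_of_le hτ.2 with rfl | hτ1
        · simpa using hend
        · rw [hline]
          exact interior_subset (hin τ ⟨hτ.1, hτ1⟩)
    have habs : |-(ε * s)| = ε * s := by rw [abs_neg, abs_of_pos hεs]
    have hX00 : X 0 0 = p := by simp [hX]
    have hpΩ : p ∈ Ω := (hmem p (Metric.mem_ball_self hρ)).2 hφp.le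
    have g1 : ‖f (X 0 0) - f (X (-(ε * s)) 0)‖ ≤ ε * (ε * s) := by
      have := hseg (-(ε * s)) 0 0 0 habs.le le_rfl hs0.le (by simpa using hεs.le) le_rfl hs0.le
        (by rwa [hX00]) (fun τ hτ => ?_)
      · simpa [abs_of_pos hε, abs_of_pos hs0] using this
      · have ha : -(ε * s) + τ * (0 - -(ε * s)) = -((1 - τ) * (ε * s)) := by ring
        have hb : (0 : ℝ) + τ * (0 - 0) = 0 := by ring
        have hpos : 0 < (1 - τ) * (ε * s) := mul_pos (by linarith [hτ.2]) hεs
        have hle : (1 - τ) * (ε * s) ≤ ε * s := by nlinarith [hτ.1]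
        have habs' : |-((1 - τ) * (ε * s))| = (1 - τ) * (ε * s) := by rw [abs_neg, abs_of_pos hpos]
        rw [ha, hb, hint _ (hball _ (hXball _ 0 (habs'.le.trans hle) le_rfl hs0.le)).1]
        have h1 := (abs_le.1 (hXφ _ 0 (habs'.le.trans hle) le_rfl hs0.le)).2
        rw [habs'] at h1
        nlinarith
    have g2 : ‖f (X (-(ε * s)) s) - f (X (-(ε * s)) 0)‖ ≤ ε * (s * T) := by
      have := hseg (-(ε * s)) 0 (-(ε * s)) s habs.le le_rfl hs0.le habs.le hs0.le le_rfl
        (interior_subset (hdown s hs0.le le_rfl)) (fun τ hτ => ?_)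
      · simpa [abs_of_pos hs0] using this
      · have ha : -(ε * s) + τ * (-(ε * s) - -(ε * s)) = -(ε * s) := by ring
        rw [ha]
        exact hdown _ (by nlinarith [hτ.1]) (by nlinarith [hτ.2])
    have g3 : ‖f (X l s) - f (X (-(ε * s)) s)‖ ≤ ε * (2 * (ε * s)) := by
      have := hseg (-(ε * s)) s l s habs.le hs0.le le_rfl hl hs0.le le_rfl
        ((hmem _ (hball _ hhball).1).2 hlz.le) (fun τ hτ => ?_)
      · refine this.trans (mul_le_mul_of_nonneg_left ?_ hε.le)
        rw [sub_self, abs_zero, zero_mul, add_zero]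
        refine (abs_sub _ _).trans ?_
        rw [habs]
        linarith
      · have hb : s + τ * (s - s) = s := by ring
        rw [hb]
        have hl' := abs_le.1 hl
        rcases eq_or_lt_of_le hl'.1 with hl2 | hl2
        · rw [← hl2]
          simpa using hdown s hs0.le le_rfl
        · have h1 : -(ε * s) + τ * (l - -(ε * s)) < l := by nlinarith [hτ.2]
          have h2 : -(ε * s) ≤ -(ε * s) + τ * (l - -(ε * s)) := by
            have := mul_nonneg hτ.1 (sub_pos.2 hl2).le
            linarith
          have h3 : |-(ε * s) + τ * (l - -(ε * s))| ≤ ε * s := abs_le.2 ⟨h2, by linarith [hl'.2]⟩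
          rw [hint _ (hball _ (hXball _ s h3 hs0.le le_rfl)).1]
          exact hlneg _ h3 h1
    have htot : ‖f (X l s) - f (X 0 0)‖ ≤ ε * (s * (3 * ε + T)) := by
      have heq : f (X l s) - f (X 0 0) = (f (X l s) - f (X (-(ε * s)) s))
          + (f (X (-(ε * s)) s) - f (X (-(ε * s)) 0)) - (f (X 0 0) - f (X (-(ε * s)) 0)) := by abel
      rw [heq]
      refine (norm_sub_le _ _).trans ((add_le_add_left (norm_add_le _ _) _).trans ?_)
      have hring : ε * (s * (3 * ε + T)) = ε * (2 * (ε * s)) + ε * (s * T) + ε * (ε * s) := by ring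
      rw [hring]
      exact add_le_add (add_le_add g3 g2) g1
    have hval : f (X l s) - f (X 0 0) = -(l • A n + s • A t) := by
      simp only [hf, huh, hX00, hup]
      simp only [hX, map_add, map_smul]
      abel
    rw [hval, norm_neg] at htot
    have hAt : s * ‖A t‖ ≤ s * (ε * (3 * ε + T + ‖A‖)) := by
      have h1 : ‖s • A t‖ ≤ ‖l • A n + s • A t‖ + ‖l • A n‖ := by
        have := norm_sub_le (l • A n + s • A t) (l • A n)
        rwa [add_sub_cancel_left] at this
      rw [norm_smul, Real.norm_of_nonneg hs0.le, norm_smul l, Real.norm_eq_abs] at h1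
      have h2 : ‖A n‖ ≤ ‖A‖ := by simpa [hn1] using A.le_opNorm n
      have h3 : |l| * ‖A n‖ ≤ ε * s * ‖A‖ := mul_le_mul hl h2 (norm_nonneg _) hεs.le
      have hring : s * (ε * (3 * ε + T + ‖A‖)) = ε * (s * (3 * ε + T)) + ε * s * ‖A‖ := by ring
      rw [hring]
      linarith only [h1, h3, htot]
    have hfin := le_of_mul_le_mul_left hAt hs0
    refine hfin.trans (mul_le_mul_of_nonneg_left ?_ hε.le)
    linarith
  have hlim : Tendsto (fun ε : ℝ => ε * (3 + T + ‖A‖)) (𝓝[>] 0) (𝓝 0) := by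
    have : Tendsto (fun ε : ℝ => ε * (3 + T + ‖A‖)) (𝓝 0) (𝓝 (0 * (3 + T + ‖A‖))) :=
      tendsto_id.mul_const _
    rw [zero_mul] at this
    exact this.mono_left nhdsWithin_le_nhds
  have hle : ‖A t‖ ≤ 0 := by
    refine ge_of_tendsto hlim ?_
    filter_upwards [Ioo_mem_nhdsGT (show (0 : ℝ) < 1 from one_pos)] with ε hε using key ε hε.1 hε.2
  exact norm_le_zero_iff.1 hle

/-- Hadamard's compatibility condition: at a regular boundary point near which the map vanishes on
the boundary, its gradient is a rank-one tensor. -/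
theorem eq_tensor_of_eventually_eq_zero {Ω : Set (Vec N)} {p n : Vec N}
    (hn : IsOuterUnitNormal Ω p n) {u : Vec N → Vec N} (hu : ContinuousOn u Ω)
    (hud : DifferentiableOn ℝ u (interior Ω)) {A : Lin N}
    (hA : Tendsto (fderiv ℝ u) (𝓝[interior Ω] p) (𝓝 A)) (hp : p ∈ frontier Ω)
    (h0 : ∀ᶠ x in 𝓝[frontier Ω] p, u x = 0) : A = tensor (A n) n := by
  ext1 x
  have h1 : inner ℝ n (x - inner ℝ n x • n) = 0 := by
    rw [inner_sub_right, inner_smul_right, real_inner_self_eq_norm_sq, hn.1]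
    ring
  have h2 := apply_eq_zero_of_tangent hn hu hud hA hp h0 h1
  rw [map_sub, map_smul, sub_eq_zero] at h2
  rw [tensor_apply, h2]

/-! ### Boundary gradients and the homogeneous solution -/

theorem defGrad_eq_fderiv {Ω : Set (Vec N)} {y : Vec N → Vec N}
    (hy : ContDiffOn ℝ 2 y (interior Ω)) {x : Vec N} (hx : x ∈ interior Ω) :
    defGrad Ω y x = fderiv ℝ y x := by
  refine extendFrom_eq (subset_closure hx) ?_
  have := (hy.continuousOn_fderiv_of_isOpen isOpen_interior one_le_two).continuousAt
    (isOpen_interior.mem_nhds hx)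
  exact this.mono_left nhdsWithin_le_nhds

theorem tendsto_fderiv_defGrad {Ω : Set (Vec N)} {y : Vec N → Vec N}
    (hy : ContDiffOn ℝ 2 y (interior Ω)) (hg : ContinuousOn (defGrad Ω y) Ω) {p : Vec N}
    (hp : p ∈ Ω) : Tendsto (fderiv ℝ y) (𝓝[interior Ω] p) (𝓝 (defGrad Ω y p)) := by
  refine ((hg p hp).mono_left (nhdsWithin_mono p interior_subset)).congr' ?_
  filter_upwards [self_mem_nhdsWithin] with x hx using defGrad_eq_fderiv hy hx

/-- In dimension zero the space is a single point, so a nonempty interior leaves no boundary point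
for `D`. -/
theorem IsPartitionedRegion.one_le {Ω D L : Set (Vec N)} (h : IsPartitionedRegion Ω D L) :
    1 ≤ N := by
  rcases Nat.eq_zero_or_pos N with rfl | hN
  · obtain ⟨x, hx⟩ := h.nonempty
    obtain ⟨z, hz⟩ := h.interior_nonempty
    have hf : x ∈ frontier Ω := h.union_eq ▸ Or.inl hx
    exact absurd (Subsingleton.elim z x ▸ hz) hf.2
  · exact hN

/-- The homogeneous deformation solves the mixed problem. -/
theorem solvesMixedProblem_of_eq {Ω D L : Set (Vec N)} (hΩ : IsPartitionedRegion Ω D L)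
    (W : Lin N → ℝ) {F₀ : Lin N} (hF₀ : F₀ ∈ LinPos N) {y : Vec N → Vec N}
    (hy : ∀ x ∈ Ω, y x = F₀ x) : SolvesMixedProblem Ω D L W F₀ y := by
  have hev : ∀ x ∈ interior Ω, y =ᶠ[𝓝 x] F₀ := fun x hx => by
    filter_upwards [isOpen_interior.mem_nhds hx] with z hz using hy z (interior_subset hz)
  have hfd : ∀ x ∈ interior Ω, fderiv ℝ y x = F₀ := fun x hx => by
    rw [(hev x hx).fderiv_eq, F₀.fderiv]
  have hgrad : ∀ x ∈ Ω, defGrad Ω y x = F₀ := fun x hx => by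
    refine extendFrom_eq (hΩ.closure_interior.symm ▸ hx) ?_
    refine tendsto_const_nhds.congr' ?_
    filter_upwards [self_mem_nhdsWithin] with z hz using (hfd z hz).symm
  have hfr : frontier Ω ⊆ Ω := hΩ.isCompact.isClosed.frontier_subset
  refine ⟨⟨?_, ?_, ?_, fun x hx => by rwa [hgrad x hx], fun x hx => ?_⟩,
    fun x hx => hy x (hfr (hΩ.union_eq ▸ Or.inl hx)),
    fun x hx n _ => by rw [hgrad x (hfr (hΩ.union_eq ▸ Or.inr hx))]⟩
  · exact F₀.contDiff.contDiffOn.congr fun x hx => hy x (interior_subset hx)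
  · exact F₀.continuous.continuousOn.congr hy
  · exact continuousOn_const.congr hgrad
  · have : (fun z => piola W (fderiv ℝ y z)) =ᶠ[𝓝 x] fun _ => piola W F₀ := by
      filter_upwards [isOpen_interior.mem_nhds hx] with z hz
      rw [hfd z hz]
    rw [tensorDiv, this.fderiv_eq]
    simp

/-! ### Uniqueness -/

theorem divergence_smul_id {c : Vec N → ℝ} {x : Vec N} (hc : HasFDerivAt c (0 : Vec N →L[ℝ] ℝ) x) :
    divergence (fun z => c z • z) x = N * c x := by
  have h : HasFDerivAt (fun z => c z • z) (c x • ContinuousLinearMap.id ℝ (Vec N)) x := by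
    refine (hc.smul (hasFDerivAt_id x)).congr_fderiv ?_
    ext1 z
    simp
  rw [divergence_eq_of_hasFDerivAt h]
  simp [basisVec_apply_self]

/-- A map on a partitioned region with vanishing gradient, equal to zero on `D`, is zero. -/
theorem eq_zero_of_fderiv_eq_zero {Ω D L : Set (Vec N)} (hΩ : IsPartitionedRegion Ω D L)
    (hpart : PartitionCondition Ω D L) {u : Vec N → Vec N} (hu : ContinuousOn u Ω)
    (hud : ContDiffOn ℝ 1 u (interior Ω)) (hu0 : ∀ x ∈ interior Ω, fderiv ℝ u x = 0)
    (hD : ∀ x ∈ D, u x = 0) : ∀ x ∈ Ω, u x = 0 := by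
  obtain ⟨E, hE, hE0, hreg, -, -⟩ := hΩ.piecewise_smooth
  have hN := hΩ.one_le
  have hint : ∀ x ∈ interior Ω, u x = 0 := by
    intro x hx
    -- The field `|u|² x` avoids having to show that every component of the interior reaches `D`.
    have h := eq_zero_of_divergence_nonneg hN hΩ.isCompact hE hE0 hreg
      (v := fun z => ‖u z‖ ^ 2 • z) (g := fun z => N * ‖u z‖ ^ 2)
      ((hu.norm.pow 2).smul continuousOn_id) ((hud.norm_sq ℝ).smul contDiffOn_id)
      (continuousOn_const.mul (hu.norm.pow 2)) (fun z _ => by positivity) (fun z hz => ?_)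
      (fun z hz n hn => ?_) x hx
    · have hN0 : (N : ℝ) ≠ 0 := by exact_mod_cast (by omega : N ≠ 0)
      simpa [hN0] using h
    · refine divergence_smul_id ?_
      have h1 := ((hud.differentiableOn one_ne_zero).differentiableAt
        (isOpen_interior.mem_nhds hz)).hasFDerivAt
      rw [hu0 z hz] at h1
      refine h1.norm_sq.congr_fderiv ?_
      ext1 w
      simp
    · rw [inner_smul_left, conj_trivial]
      rcases (hΩ.union_eq ▸ hz.1 : z ∈ D ∪ L) with hzD | hzL
      · simp [hD z hzD]
      · exact mul_nonpos_of_nonneg_of_nonpos (by positivity) (hpart.2 z hzL n hn)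
  intro x hx
  have hcl : x ∈ closure (interior Ω) := hΩ.closure_interior.symm ▸ hx
  have hne := mem_closure_iff_nhdsWithin_neBot.1 hcl
  refine tendsto_nhds_unique ((hu x hx).mono_left (nhdsWithin_mono x interior_subset)) ?_
  refine tendsto_const_nhds.congr' ?_
  filter_upwards [self_mem_nhdsWithin] with z hz using (hint z hz).symm

theorem SolvesMixedProblem.eq {Ω D L : Set (Vec N)} (hΩ : IsPartitionedRegion Ω D L)
    (hpart : PartitionCondition Ω D L) {W : Lin N → ℝ} (hW : ContDiffOn ℝ 2 W (LinPos N))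
    (hrank : RankOneConvex W) {F₀ : Lin N} (hF₀ : F₀ ∈ LinPos N) (hstrict : StrictConvexityPoint W F₀)
    {y : Vec N → Vec N} (h : SolvesMixedProblem Ω D L W F₀ y) : ∀ x ∈ Ω, y x = F₀ x := by
  obtain ⟨E, hE, hE0, hreg, hDopen, -⟩ := hΩ.piecewise_smooth
  obtain ⟨⟨hy, hyc, hgc, hgpos, hdiv⟩, hdisp, htrac⟩ := h
  have hN := hΩ.one_le
  have hfr : frontier Ω ⊆ Ω := hΩ.isCompact.isClosed.frontier_subset
  have hgf : ∀ x ∈ interior Ω, defGrad Ω y x = fderiv ℝ y x := fun x hx => defGrad_eq_fderiv hy hx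
  have hpos : MapsTo (defGrad Ω y) Ω (LinPos N) := hgpos
  have hexc : ∀ F ∈ LinPos N, 0 ≤ W F - W F₀ - fderiv ℝ W F₀ (F - F₀) := by
    intro F hF
    by_cases hne : F = F₀
    · simp [hne]
    · linarith [hstrict F hF hne]
  have huc : ContinuousOn (fun z => y z - F₀ z) Ω := hyc.sub F₀.continuous.continuousOn
  have hud : ContDiffOn ℝ 1 (fun z => y z - F₀ z) (interior Ω) :=
    (hy.of_le one_le_two).sub F₀.contDiff.contDiffOn
  have hufd : ∀ x ∈ interior Ω, fderiv ℝ (fun z => y z - F₀ z) x = fderiv ℝ y x - F₀ := by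
    intro x hx
    have h1 := ((hy.differentiableOn two_ne_zero).differentiableAt
      (isOpen_interior.mem_nhds hx)).hasFDerivAt
    exact (h1.sub F₀.hasFDerivAt).fderiv
  have heq : ∀ z ∈ interior Ω, energyFlux W F₀ (defGrad Ω y) y z
      = energyFlux W F₀ (fderiv ℝ y) y z := fun z hz => by
    simp only [energyFlux, hgf z hz]
  have hexcess : ∀ x ∈ interior Ω,
      (N : ℝ) * (W (defGrad Ω y x) - W F₀ - fderiv ℝ W F₀ (defGrad Ω y x - F₀)) = 0 := by
    refine eq_zero_of_divergence_nonneg hN hΩ.isCompact hE hE0 hreg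
      (v := energyFlux W F₀ (defGrad Ω y) y) (continuousOn_energyFlux hW F₀ hgc hpos hyc) ?_ ?_
      (fun x hx => mul_nonneg (Nat.cast_nonneg N) (hexc _ (hgpos x (interior_subset hx)))) ?_ ?_
    · refine (contDiffOn_energyFlux hW F₀ (hy.fderiv_of_isOpen isOpen_interior (by norm_num))
        (fun x hx => ?_) (hy.of_le one_le_two)).congr heq
      rw [← hgf x hx]
      exact hgpos x (interior_subset hx)
    · refine continuousOn_const.mul ?_
      exact ((hW.continuousOn.comp hgc hpos).sub continuousOn_const).sub
        ((fderiv ℝ W F₀).continuous.comp_continuousOn (hgc.sub continuousOn_const))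
    · intro x hx
      have hev : energyFlux W F₀ (defGrad Ω y) y =ᶠ[𝓝 x] energyFlux W F₀ (fderiv ℝ y) y := by
        filter_upwards [isOpen_interior.mem_nhds hx] with z hz using heq z hz
      rw [divergence, hev.fderiv_eq, hgf x hx]
      refine divergence_energyFlux hW F₀ (hy.contDiffAt (isOpen_interior.mem_nhds hx)) ?_
        (hdiv x hx)
      rw [← hgf x hx]
      exact hgpos x (interior_subset hx)
    · intro x hx n hn
      have hxΩ := hfr hx.1
      set F := defGrad Ω y x with hF
      rw [inner_energyFlux, ← hF]
      rcases (hΩ.union_eq ▸ hx.1 : x ∈ D ∪ L) with hxD | hxL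
      -- Off `E` the set `D` is relatively open in the frontier, so the displacement condition holds
      -- on a whole boundary neighbourhood, as Hadamard's condition requires.
      · have h0 : ∀ᶠ z in 𝓝[frontier Ω] x, y z - F₀ z = 0 := by
          filter_upwards [hDopen x ⟨hxD, hx.2⟩] with z hz
          rw [hdisp z hz, sub_self]
        have htend : Tendsto (fderiv ℝ fun z => y z - F₀ z) (𝓝[interior Ω] x) (𝓝 (F - F₀)) := by
          refine ((tendsto_fderiv_defGrad hy hgc hxΩ).sub_const F₀).congr' ?_
          filter_upwards [self_mem_nhdsWithin] with z hz using (hufd z hz).symm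
        have hrk := eq_tensor_of_eventually_eq_zero hn huc (hud.differentiableOn one_ne_zero) htend
          hx.1 h0
        set a := (F - F₀) n with ha
        have hneg : F₀ - F = tensor (-a) n := by
          rw [← tensorLeft_apply, map_neg, tensorLeft_apply, ← hrk, neg_sub]
        have hw : y x - F x = (-inner ℝ x n) • a := by
          have h1 : (F - F₀) x = inner ℝ n x • a := by rw [hrk, tensor_apply]
          rw [hdisp x hxD, neg_smul, real_inner_comm, ← h1, sub_apply, neg_sub]
        -- Rank-one convexity is applied with base point `F` and end point `F₀`: in `v · n` the
        -- terms with `S(F₀)` cancel and only `S(F)` remains.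
        have hconv := hrank F₀ hF₀ F (hgpos x hxΩ) (-a) n hneg
        rw [hw, ← tensorLeft_apply, map_smul, map_smul, tensorLeft_apply, ← hrk, smul_eq_mul,
          sub_apply]
        have hsw : fderiv ℝ W F (F₀ - F) = -fderiv ℝ W F (F - F₀) := by rw [← map_neg, neg_sub]
        rw [hsw] at hconv
        have hxn := hpart.1 x hxD n hn
        have := mul_nonneg hxn (sub_nonneg.2 hconv)
        linarith
      · have h1 : (fderiv ℝ W F - fderiv ℝ W F₀) (tensor (y x - F x) n) = 0 := by
          rw [sub_apply, ← inner_piola_apply, ← inner_piola_apply, htrac x hxL n hn, sub_self]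
        rw [h1, add_zero]
        exact mul_nonpos_of_nonneg_of_nonpos (hexc F (hgpos x hxΩ)) (hpart.2 x hxL n hn)
  have hgrad : ∀ x ∈ interior Ω, fderiv ℝ y x = F₀ := by
    intro x hx
    by_contra hne
    have hN0 : (N : ℝ) ≠ 0 := by exact_mod_cast (by omega : N ≠ 0)
    have h1 := (mul_eq_zero.1 (hexcess x hx)).resolve_left hN0
    rw [hgf x hx] at h1
    have h2 := hstrict (fderiv ℝ y x) (hgf x hx ▸ hgpos x (interior_subset hx)) hne
    linarith
  have hzero := eq_zero_of_fderiv_eq_zero hΩ hpart huc hud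
    (fun x hx => by rw [hufd x hx, hgrad x hx, sub_self]) (fun x hx => by rw [hdisp x hx, sub_self])
  exact fun x hx => sub_eq_zero.1 (hzero x hx)

end

end Elastostatics

theorem proposition3 {N : ℕ} (Ω D L : Set (Elastostatics.Vec N))
    (hΩ : Elastostatics.IsPartitionedRegion Ω D L)
    (hpart : Elastostatics.PartitionCondition Ω D L)
    (W : Elastostatics.Lin N → ℝ) (hW : ContDiffOn ℝ 2 W (Elastostatics.LinPos N))
    (hrank : Elastostatics.RankOneConvex W)
    (F₀ : Elastostatics.Lin N) (hF₀ : F₀ ∈ Elastostatics.LinPos N)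
    (hstrict : Elastostatics.StrictConvexityPoint W F₀)
    (y : Elastostatics.Vec N → Elastostatics.Vec N) :
    Elastostatics.SolvesMixedProblem Ω D L W F₀ y ↔ ∀ x ∈ Ω, y x = F₀ x := by
  constructor
  · exact fun h => h.eq hΩ hpart hW hrank hF₀ hstrict
  · exact fun h => Elastostatics.solvesMixedProblem_of_eq hΩ W hF₀ h
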